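/- **Setting.** A graphon is a symmetric measurable function $W:[0,1]^2\to[0,1]$; $T_WX(u)=\int_0^1W(u,v)X(v)\,dv$ on $L^2=L^2([0,1])$ (real valued). Let $L,K\ge 0$ be integers, $\sigma:\mathbb R\to\mathbb R$ a $1$-Lipschitz function, and $\mathcal H=\{h_{l,k}\}_{1\le l\le L,\,0\le k<K}$ a fixed (hence bounded) finite family of real weights. The graphon neural network with one feature per layer is $X_0=X\in L^2$, $U_l=\sum_{k<K}h_{l,k}T_W^kX_{l-1}$, $X_l=\sigma(U_l)$, $f(X;W,\mathcal H)=X_L$. Its tangent kernel is the operator on $L^2$ $$\Theta(X,X';W,\mathcal H)=\sum_{l,k}\partial_{h_{l,k}}f(X;W,\mathcal H)\otimes\partial_{h_{l,k}}f(X';W,\mathcal H),\qquad (a\otimes b)Y=a\int_0^1bY,$$ where $\partial_{h_{l,k}}f$ is given by the chain rule: $\partial_{h_{l,k}}X_l=\sigma'(U_l)\,T_W^kX_{l-1}$ and $\partial_{h_{l,k}}X_m=\sigma'(U_m)\sum_{j<K}h_{m,j}T_W^j\,\partial_{h_{l,k}}X_{m-1}$ for $m>l$ (with $\sigma'=0$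 at points where $\sigma$ is not differentiable). For each $n$ let $G_n$ be an undirected graph on $n$ nodes with edge weights $w_n(i,j)=w_n(j,i)\in[0,1]$, and let $x_{1,n},\dots,x_{M,n}\in\mathbb R^n$ be signals on $G_n$. With $I_i=[(i-1)/n,i/n)$ for $i<n$ and $I_n=[(n-1)/n,1]$, the induced graphon is $W_n(u,v)=w_n(i,j)$ for $u\in I_i,\ v\in I_j$, and the induced signals are $X_{i,n}(u)=[x_{i,n}]_j$ for $u\in I_j$. For a permutation $\pi_n$ of the nodes, $W_n^{\pi_n}$ and $X_{i,n}^{\pi_n}$ denote the objects induced after relabelling the nodes of $G_n$ and of all its signals by $\pi_n$. **Theorem.** Let $W$ be a graphon and $X_1,\dots,X_M\in L^2$. Assume that $G_n\to W$ in the sense that all homomorphism densities of finite simple graphs converge, and that $(G_n,x_{i,n})\to(W,X_i)$ for all $i$, up to relabellings $\pi_n$ of the nodes that do not depend on $i$, in the sense that $W_n^{\pi_n}\to W$ in the cut norm and $\|X_{i,n}^{\pi_n}-X_i\|_{L^2}\to0$. Assume moreover that, for every $i$ and every $1\le l\le L$, for almost every $u\in[0,1]$, $\sigma$ is differentiable at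 $U_l(u)$ and $\sigma'$ is continuous at $U_l(u)$, where $U_l$ is computed from $(W,X_i)$ (this always holds if $\sigma$ is continuously differentiable). Define operators on $L^2([0,1])^M$ by $[\Theta_n]_{ij}=\Theta(X_{i,n},X_{j,n};W_n,\mathcal H)$, $[\Theta_n^{\pi}]_{ij}=\Theta(X_{i,n}^{\pi_n},X_{j,n}^{\pi_n};W_n^{\pi_n},\mathcal H)$ and $[\Theta]_{ij}=\Theta(X_i,X_j;W,\mathcal H)$. For a compact self-adjoint operator $T$ let $\lambda_p(T)$, $p\in\mathbb Z\setminus\{0\}$, be its eigenvalues counted with multiplicity, $\lambda_{-1}\le\lambda_{-2}\le\dots\le0\le\dots\le\lambda_2\le\lambda_1$, where the list of positive eigenvalues ($p>0$) and that of negative eigenvalues ($p<0$) are continued by zeros if they are finite. Then all $\Theta_n$, $\Theta_n^\pi$, $\Theta$ are compact and self-adjoint, and: 1. for every $p\ne0$, $\lim_{n\to\infty}|\lambda_p(\Theta_n)-\lambda_p(\Theta)|=0$, and $\lambda_p(\Theta_n^\pi)=\lambda_p(\Theta_n)$ for all $n$; 2. for every $p\neq 0$ with $\lambda_p(\Theta)\neq0$,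 the orthogonal projection onto the span of the eigenspaces of $\Theta_n^\pi$ for the eigenvalues $\lambda_q(\Theta_n^\pi)$, $q\in\{q\ne0:\lambda_q(\Theta)=\lambda_p(\Theta)\}$, converges in operator norm to the orthogonal projection onto the eigenspace of $\Theta$ for $\lambda_p(\Theta)$. (If $\lambda_p(\Theta)$ is simple, these are the projections onto the eigenspaces of the $p$-th eigenvalues.) -/

import Mathlib

open MeasureTheory Filter Topology

noncomputable section

namespace GNTK

/-! ### Graphs, graphons and homomorphism densities -/

/-- An undirected graph on `n` nodes with edge weights `w i j ∈ [0, 1]` (weight `0` means that there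
is no edge; an unweighted graph has weights `0` and `1`). -/
structure WGraph (n : ℕ) where
  w : Fin n → Fin n → ℝ
  symm : ∀ i j, w i j = w j i
  nonneg : ∀ i j, 0 ≤ w i j
  le_one : ∀ i j, w i j ≤ 1

/-- A graphon: a symmetric measurable function `[0,1]² → [0,1]`. -/
structure Graphon where
  toFun : unitInterval → unitInterval → ℝ
  measurable : Measurable (Function.uncurry toFun)
  symm : ∀ u v, toFun u v = toFun v u
  nonneg : ∀ u v, 0 ≤ toFun u v
  le_one : ∀ u v, toFun u v ≤ 1

instance : CoeFun Graphon (fun _ => unitInterval → unitInterval → ℝ) := ⟨Graphon.toFun⟩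

open Classical in
/-- The homomorphism density `t(F, G) = hom(F, G) / n ^ |V(F)|`, where `hom(F, G)` is the
(weighted) number of homomorphisms of `F` into `G`. -/
def WGraph.homDensity {n m : ℕ} (F : SimpleGraph (Fin m)) (G : WGraph n) : ℝ :=
  (∑ φ : Fin m → Fin n, ∏ i, ∏ j, if i < j ∧ F.Adj i j then G.w (φ i) (φ j) else 1) / (n : ℝ) ^ m

open Classical in
/-- The homomorphism density `t(F, W) = ∫ ∏_{ij ∈ E(F)} W(u_i, u_j) du`. -/
def Graphon.homDensity {m : ℕ} (F : SimpleGraph (Fin m)) (W : Graphon) : ℝ :=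
  ∫ u : Fin m → unitInterval, ∏ i, ∏ j, if i < j ∧ F.Adj i j then W (u i) (u j) else 1

/-- `G_n → W`: all homomorphism densities of finite simple graphs converge. -/
def GraphsConverge (G : ∀ n, WGraph n) (W : Graphon) : Prop :=
  ∀ (m : ℕ) (F : SimpleGraph (Fin m)),
    Tendsto (fun n => (G n).homDensity F) atTop (𝓝 (W.homDensity F))

/-- The cut norm of a bounded measurable kernel on `[0,1]²`. -/
def cutNorm (k : unitInterval → unitInterval → ℝ) : ℝ :=
  ⨆ S : {S : Set unitInterval × Set unitInterval // MeasurableSet S.1 ∧ MeasurableSet S.2},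
    |∫ z in S.1.1 ×ˢ S.1.2, k z.1 z.2|

/-! ### Relabelled graphs and induced graphon signals -/

/-- The graph with its nodes relabelled by a permutation. -/
def WGraph.relabel {n : ℕ} (G : WGraph n) (π : Equiv.Perm (Fin n)) : WGraph n where
  w i j := G.w (π i) (π j)
  symm _ _ := G.symm _ _
  nonneg _ _ := G.nonneg _ _
  le_one _ _ := G.le_one _ _

/-- The cells `[i/n, (i+1)/n)` for `i < n - 1`, and `[(n-1)/n, 1]` for `i = n - 1`. -/
def cell (n : ℕ) (i : Fin n) : Set unitInterval :=
  {u | (i : ℝ) / n ≤ u ∧ ((u : ℝ) < ((i : ℝ) + 1) / n ∨ (i : ℕ) + 1 = n)}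

lemma measurableSet_cell (n : ℕ) (i : Fin n) : MeasurableSet (cell n i) := by
  have h1 : Measurable fun u : unitInterval => (u : ℝ) := measurable_subtype_coe
  exact (measurableSet_le measurable_const h1).inter
    ((measurableSet_lt h1 measurable_const).union (MeasurableSet.const _))

lemma cell_disjoint {n : ℕ} {i j : Fin n} {u : unitInterval} (hi : u ∈ cell n i) (hj : u ∈ cell n j) :
    i = j := by
  have hn : (0 : ℝ) < n := by exact_mod_cast (Fin.pos i)
  have key : ∀ a b : Fin n, u ∈ cell n a → u ∈ cell n b → a ≤ b := by
    intro a b ha hb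
    rcases hb.2 with h | h
    · have h2 := lt_of_le_of_lt ha.1 h
      rw [div_lt_div_iff_of_pos_right hn] at h2
      have h3 : (a : ℕ) < (b : ℕ) + 1 := by exact_mod_cast h2
      exact Fin.le_def.2 (by omega)
    · exact Fin.le_def.2 (by have := a.2; omega)
  exact le_antisymm (key i j hi hj) (key j i hj hi)

open Classical in
/-- The graphon induced by a graph, `W_n(u, v) = ∑ i j, w i j 𝟙(u ∈ I_i) 𝟙(v ∈ I_j)`. -/
def WGraph.inducedGraphon {n : ℕ} (G : WGraph n) : Graphon where
  toFun u v := ∑ i, ∑ j, if u ∈ cell n i ∧ v ∈ cell n j then G.w i j else 0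
  measurable := by
    refine Finset.measurable_fun_sum _ fun i _ => Finset.measurable_fun_sum _ fun j _ => ?_
    exact Measurable.ite (((measurableSet_cell n i).preimage measurable_fst).inter
      ((measurableSet_cell n j).preimage measurable_snd)) measurable_const measurable_const
  symm u v := by
    rw [Finset.sum_comm]
    refine Finset.sum_congr rfl fun i _ => Finset.sum_congr rfl fun j _ => ?_
    rw [G.symm j i]
    simp only [and_comm]
  nonneg u v := Finset.sum_nonneg fun i _ => Finset.sum_nonneg fun j _ => by
    split_ifs
    · exact G.nonneg i j
    · exact le_rfl
  le_one u v := by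
    by_cases h : ∃ a b, u ∈ cell n a ∧ v ∈ cell n b
    · obtain ⟨a, b, ha, hb⟩ := h
      rw [Finset.sum_eq_single a, Finset.sum_eq_single b]
      · rw [if_pos ⟨ha, hb⟩]
        exact G.le_one a b
      · intro j _ hj
        exact if_neg fun h => hj (cell_disjoint h.2 hb)
      · simp
      · intro i _ hi
        exact Finset.sum_eq_zero fun j _ => if_neg fun h => hi (cell_disjoint h.1 ha)
      · simp
    · rw [Finset.sum_eq_zero]
      · exact zero_le_one
      · intro i _
        exact Finset.sum_eq_zero fun j _ => if_neg fun h' => h ⟨i, j, h'⟩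

/-- Graphon signals: the Hilbert space `L²([0,1])`. -/
abbrev Signal : Type := Lp ℝ 2 (volume : Measure unitInterval)

open Classical in
lemma memLp_inducedSignal {n : ℕ} (x : Fin n → ℝ) :
    MemLp (fun u : unitInterval => ∑ i, if u ∈ cell n i then x i else 0) 2 volume := by
  refine memLp_finsetSum _ fun i _ => ?_
  have h : (fun u : unitInterval => if u ∈ cell n i then x i else 0)
      = (cell n i).indicator (fun _ => x i) := by
    ext u
    simp [Set.indicator_apply]
  rw [h]
  exact (memLp_const (x i)).indicator (measurableSet_cell n i)

/-- The graphon signal induced by a graph signal, `X_n(u) = ∑ i, x i 𝟙(u ∈ I_i)`. -/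
def inducedSignal {n : ℕ} (x : Fin n → ℝ) : Signal := (memLp_inducedSignal x).toLp _

/-! ### Graphon neural networks (one feature per layer) -/

lemma integral_abs_le_norm (X : Signal) : ∫ v, |X v| ≤ ‖X‖ := by
  have h1 : eLpNorm X 1 volume ≤ eLpNorm X 2 volume :=
    eLpNorm_le_eLpNorm_of_exponent_le (by norm_num) (Lp.aestronglyMeasurable X)
  have h2 : ∫ v, |X v| = (eLpNorm X 1 volume).toReal := by
    rw [eLpNorm_one_eq_lintegral_enorm, ← integral_norm_eq_lintegral_enorm
      (Lp.aestronglyMeasurable X)]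
    rfl
  rw [h2, Lp.norm_def]
  exact ENNReal.toReal_mono (Lp.eLpNorm_ne_top X) h1

lemma signal_integrable (X : Signal) : Integrable X volume :=
  (Lp.memLp X).integrable (by norm_num)

lemma Graphon.integrable_mul (W : Graphon) (X : Signal) (u : unitInterval) :
    Integrable (fun v => W u v * X v) volume := by
  refine (signal_integrable X).bdd_mul (c := 1)
    (W.measurable.comp measurable_prodMk_left).aestronglyMeasurable ?_
  exact Eventually.of_forall fun v => by
    change ‖W u v‖ ≤ 1
    rw [Real.norm_of_nonneg (W.nonneg u v)]
    exact W.le_one u v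

lemma Graphon.abs_integral_le (W : Graphon) (X : Signal) (u : unitInterval) :
    ‖∫ v, W u v * X v‖ ≤ ‖X‖ := by
  refine (norm_integral_le_integral_norm _).trans (le_trans ?_ (integral_abs_le_norm X))
  refine integral_mono (W.integrable_mul X u).norm (signal_integrable X).norm fun v => ?_
  simp only [norm_mul, Real.norm_eq_abs]
  rw [abs_of_nonneg (W.nonneg u v)]
  exact mul_le_of_le_one_left (abs_nonneg _) (W.le_one u v)

lemma Graphon.memLp_integral (W : Graphon) (X : Signal) :
    MemLp (fun u => ∫ v, W u v * X v) 2 volume := by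
  refine MemLp.of_bound ?_ ‖X‖ (Eventually.of_forall (W.abs_integral_le X))
  refine StronglyMeasurable.aestronglyMeasurable ?_
  refine StronglyMeasurable.integral_prod_right (f := fun u v => W u v * X v) ?_
  exact (W.measurable.stronglyMeasurable).mul
    ((Lp.stronglyMeasurable X).comp_measurable measurable_snd)

/-- The function `u ↦ ∫₀¹ W(u, v) X(v) dv` as an element of `L²([0,1])`. -/
def Graphon.opFun (W : Graphon) (X : Signal) : Signal := (W.memLp_integral X).toLp _

lemma Graphon.opFun_ae (W : Graphon) (X : Signal) :
    ∀ᵐ u, W.opFun X u = ∫ v, W u v * X v :=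
  (W.memLp_integral X).coeFn_toLp

/-- The graphon operator `(T_W X)(u) = ∫₀¹ W(u, v) X(v) dv` on `L²([0,1])`. -/
def Graphon.op (W : Graphon) : Signal →L[ℝ] Signal :=
  LinearMap.mkContinuous
    { toFun := W.opFun
      map_add' := fun X Y => by
        rw [Graphon.opFun, Graphon.opFun, Graphon.opFun, ← MemLp.toLp_add]
        refine MemLp.toLp_congr _ _ (Eventually.of_forall fun u => ?_)
        simp only [Pi.add_apply]
        rw [← integral_add (W.integrable_mul X u) (W.integrable_mul Y u)]
        refine integral_congr_ae ?_
        filter_upwards [Lp.coeFn_add X Y] with v hv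
        rw [hv, Pi.add_apply, mul_add]
      map_smul' := fun c X => by
        rw [RingHom.id_apply, Graphon.opFun, Graphon.opFun, ← MemLp.toLp_const_smul]
        refine MemLp.toLp_congr _ _ (Eventually.of_forall fun u => ?_)
        simp only [Pi.smul_apply, smul_eq_mul]
        rw [← integral_const_mul]
        refine integral_congr_ae ?_
        filter_upwards [Lp.coeFn_smul c X] with v hv
        rw [hv, Pi.smul_apply, smul_eq_mul]
        ring }
    1
    (fun X => by
      have h : ∀ᵐ u : unitInterval, ‖W.opFun X u‖ ≤ ‖X‖ := by
        filter_upwards [W.opFun_ae X] with u hu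
        rw [hu]
        exact W.abs_integral_le X u
      have := Lp.norm_le_of_ae_bound (norm_nonneg X) h
      have h1 : measureUnivNNReal (volume : Measure unitInterval) = 1 := by simp [measureUnivNNReal]
      rw [h1] at this
      simpa using this)

lemma Graphon.op_apply (W : Graphon) (X : Signal) : W.op X = W.opFun X := rfl

/-- The graphon convolution `T_H X = ∑_{k < K} h_k T_W^k X`. -/
def conv (K : ℕ) (c : ℕ → ℝ) (W : Graphon) : Signal →L[ℝ] Signal :=
  ∑ k ∈ Finset.range K, c k • W.op ^ k

lemma memLp_activation {σ : ℝ → ℝ} (hσ : LipschitzWith 1 σ) (U : Signal) :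
    MemLp (fun u => σ (U u)) 2 volume := by
  have h1 : MemLp (fun u => |σ 0| + ‖U u‖) 2 (volume : Measure unitInterval) :=
    MemLp.add (f := fun _ => |σ 0|) (g := fun u => ‖U u‖) (memLp_const _) (Lp.memLp U).norm
  refine h1.mono (hσ.continuous.comp_aestronglyMeasurable (Lp.aestronglyMeasurable U)) ?_
  refine Eventually.of_forall fun u => ?_
  have h2 : |σ (U u) - σ 0| ≤ |U u| := by
    have := hσ.dist_le_mul (U u) 0
    simpa [Real.dist_eq] using this
  rw [Real.norm_of_nonneg (add_nonneg (abs_nonneg _) (norm_nonneg _)), Real.norm_eq_abs,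
    Real.norm_eq_abs]
  calc |σ (U u)| = |σ 0 + (σ (U u) - σ 0)| := by ring_nf
    _ ≤ |σ 0| + |σ (U u) - σ 0| := abs_add_le _ _
    _ ≤ |σ 0| + |U u| := by linarith

/-- The pointwise nonlinearity `σ(U)`. -/
def activation {σ : ℝ → ℝ} (hσ : LipschitzWith 1 σ) (U : Signal) : Signal :=
  (memLp_activation hσ U).toLp _

lemma memLp_deriv_mul {σ : ℝ → ℝ} (hσ : LipschitzWith 1 σ) (U V : Signal) :
    MemLp (fun u => deriv σ (U u) * V u) 2 volume := by
  refine (Lp.memLp V).mono ?_ ?_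
  · exact ((measurable_deriv σ).comp_aemeasurable
      (Lp.aestronglyMeasurable U).aemeasurable).aestronglyMeasurable.mul
        (Lp.aestronglyMeasurable V)
  · refine Eventually.of_forall fun u => ?_
    have h := norm_deriv_le_of_lipschitz hσ (x₀ := U u)
    rw [norm_mul]
    exact mul_le_of_le_one_left (norm_nonneg _) (by simpa using h)

/-- The pointwise product `σ'(U) V`. -/
def derivMul {σ : ℝ → ℝ} (hσ : LipschitzWith 1 σ) (U V : Signal) : Signal :=
  (memLp_deriv_mul hσ U V).toLp _

/-- The layer outputs of the graphon neural network with `h l k` the `k`-th weight (`k < K`) of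
layer `l ≥ 1`: `X_0 = X` and `X_l = σ(T_{H_l} X_{l-1})`. -/
def layer {σ : ℝ → ℝ} (hσ : LipschitzWith 1 σ) (K : ℕ) (h : ℕ → ℕ → ℝ) (W : Graphon)
    (X : Signal) : ℕ → Signal
  | 0 => X
  | l + 1 => activation hσ (conv K (h (l + 1)) W (layer hσ K h W X l))

/-- The pre-activations `U_l = T_{H_l} X_{l-1}`, for `l ≥ 1`. -/
def preact {σ : ℝ → ℝ} (hσ : LipschitzWith 1 σ) (K : ℕ) (h : ℕ → ℕ → ℝ) (W : Graphon)
    (X : Signal) (l : ℕ) : Signal :=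
  conv K (h l) W (layer hσ K h W X (l - 1))

/-- The partial derivative of the layer output `X_m` in the weight `h l k`, for `l ≥ 1` and `k < K`:
it is `σ'(U_l) T_W^k X_{l-1}` for `m = l`, and `σ'(U_m) T_{H_m} (∂X_{m-1})` for `m > l`.
That this is the derivative in `L²([0,1])` is `hasDerivAt_layer` below. -/
def layerDeriv {σ : ℝ → ℝ} (hσ : LipschitzWith 1 σ) (K : ℕ) (h : ℕ → ℕ → ℝ) (W : Graphon)
    (X : Signal) (l k : ℕ) : ℕ → Signal
  | 0 => 0
  | m + 1 =>
    derivMul hσ (preact hσ K h W X (m + 1))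
      (if m + 1 = l then (W.op ^ k) (layer hσ K h W X m)
        else conv K (h (m + 1)) W (layerDeriv hσ K h W X l k m))

/-- The neural tangent kernel of the `L`-layer graphon neural network `f = X_L`: the operator
`Θ(X, X') = ∑_{l,k} ∂_{h_{l,k}} f(X) ⊗ ∂_{h_{l,k}} f(X')` on `L²([0,1])`, with
`(a ⊗ b) Y = a ∫₀¹ b(v) Y(v) dv`. -/
def wntk {σ : ℝ → ℝ} (hσ : LipschitzWith 1 σ) (L K : ℕ) (h : ℕ → ℕ → ℝ) (W : Graphon)
    (X X' : Signal) : Signal →L[ℝ] Signal :=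
  ∑ l ∈ Finset.Icc 1 L, ∑ k ∈ Finset.range K,
    InnerProductSpace.rankOne ℝ (layerDeriv hσ K h W X l k L) (layerDeriv hσ K h W X' l k L)

/-- The Hilbert space `L²([0,1])^M`. -/
abbrev Signals (M : ℕ) : Type := PiLp 2 (fun _ : Fin M => Signal)

/-- The operator on `L²([0,1])^M` with the given matrix entries: `(A Y)_i = ∑_j A_{ij} Y_j`. -/
def blockOp {M : ℕ} (A : Fin M → Fin M → Signal →L[ℝ] Signal) : Signals M →L[ℝ] Signals M :=
  ((PiLp.continuousLinearEquiv 2 ℝ (fun _ : Fin M => Signal)).symm :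
      (Fin M → Signal) →L[ℝ] Signals M) ∘L
    ContinuousLinearMap.pi fun i =>
      ∑ j, A i j ∘L PiLp.proj (𝕜 := ℝ) 2 (fun _ : Fin M => Signal) j

/-- The matrix operator `[Θ(X_i, X_j; W, H)]_{ij}` on `L²([0,1])^M`. -/
def ntkMatrix {σ : ℝ → ℝ} (hσ : LipschitzWith 1 σ) (L K : ℕ) (h : ℕ → ℕ → ℝ) (W : Graphon)
    {M : ℕ} (X : Fin M → Signal) : Signals M →L[ℝ] Signals M :=
  blockOp fun i j => wntk hσ L K h W (X i) (X j)

/-! ### Ordered eigenvalues and spectral projectors of compact self-adjoint operators -/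

section Spectral

variable {E : Type*} [NormedAddCommGroup E] [InnerProductSpace ℝ E]

/-- The eigenspace of `T` for `μ` (`⊥` if `μ` is not an eigenvalue). -/
def eigSpace (T : E →L[ℝ] E) (μ : ℝ) : Submodule ℝ E :=
  Module.End.eigenspace (T : E →ₗ[ℝ] E) μ

/-- The `p`-th largest positive eigenvalue (`p ≥ 1`) of a compact self-adjoint operator, counted
with multiplicity: the largest eigenvalue `μ > 0` such that at least `p` eigenvalues are `≥ μ`.
It is `0` if `T` has fewer than `p` positive eigenvalues. -/
def posEig (T : E →L[ℝ] E) (p : ℕ) : ℝ :=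
  sSup {μ : ℝ | 0 < μ ∧ eigSpace T μ ≠ ⊥ ∧
    p ≤ Module.finrank ℝ (⨆ ν ∈ Set.Ici μ, eigSpace T ν : Submodule ℝ E)}

/-- The eigenvalues `λ_p(T)`, `p ∈ ℤ \ {0}`, of a compact self-adjoint operator, counted with
multiplicity, with `λ_{-1} ≤ λ_{-2} ≤ … ≤ 0 ≤ … ≤ λ_2 ≤ λ_1`: the positive eigenvalues have
positive indices, the negative ones negative indices, and a list that is finite is continued by
zeros. -/
def eig (T : E →L[ℝ] E) (p : ℤ) : ℝ :=
  if 0 < p then posEig T p.toNat else -posEig (-T) (-p).toNat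

/-- The spectral projector of a compact self-adjoint operator for a set `S` of real numbers: the
orthogonal projection onto the closed span of all eigenspaces with eigenvalues in `S`. -/
def spectralProj [CompleteSpace E] (T : E →L[ℝ] E) (S : Set ℝ) : E →L[ℝ] E :=
  (⨆ μ ∈ S, eigSpace T μ).topologicalClosure.starProjection

end Spectral

/-! ### The derivative of the network in its weights -/

lemma norm_activation_sub_le {σ : ℝ → ℝ} (hσ : LipschitzWith 1 σ) (U V : Signal) :
    ‖activation hσ U - activation hσ V‖ ≤ ‖U - V‖ := by
  refine Lp.norm_le_norm_of_ae_le ?_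
  filter_upwards [Lp.coeFn_sub (activation hσ U) (activation hσ V), Lp.coeFn_sub U V,
    (memLp_activation hσ U).coeFn_toLp, (memLp_activation hσ V).coeFn_toLp] with u h1 h2 h3 h4
  rw [h1, h2, Pi.sub_apply, Pi.sub_apply, activation, activation, h3, h4]
  have := hσ.dist_le_mul (U u) (V u)
  simpa [Real.dist_eq] using this

/-- The chain rule for the pointwise nonlinearity in `L²([0,1])`. -/
lemma hasDerivAt_activation {σ : ℝ → ℝ} (hσ : LipschitzWith 1 σ) {g : ℝ → Signal} {v : Signal}
    {t₀ : ℝ} (hg : HasDerivAt g v t₀) (hd : ∀ᵐ u, DifferentiableAt ℝ σ (g t₀ u)) :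
    HasDerivAt (fun t => activation hσ (g t)) (derivMul hσ (g t₀) v) t₀ := by
  rw [hasDerivAt_iff_tendsto_slope_zero] at hg ⊢
  set F : ℝ → Signal := fun s =>
    s⁻¹ • (activation hσ (g t₀ + s • v) - activation hσ (g t₀)) - derivMul hσ (g t₀) v with hF
  have key : Tendsto F (𝓝[≠] 0) (𝓝 0) := by
    have hae : ∀ s : ℝ, ∀ᵐ u, F s u
        = s⁻¹ * (σ (g t₀ u + s * v u) - σ (g t₀ u)) - deriv σ (g t₀ u) * v u := by
      intro s
      filter_upwards [Lp.coeFn_sub (s⁻¹ • (activation hσ (g t₀ + s • v) - activation hσ (g t₀)))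
          (derivMul hσ (g t₀) v),
        Lp.coeFn_smul s⁻¹ (activation hσ (g t₀ + s • v) - activation hσ (g t₀)),
        Lp.coeFn_sub (activation hσ (g t₀ + s • v)) (activation hσ (g t₀)),
        (memLp_activation hσ (g t₀ + s • v)).coeFn_toLp, (memLp_activation hσ (g t₀)).coeFn_toLp,
        (memLp_deriv_mul hσ (g t₀) v).coeFn_toLp, Lp.coeFn_add (g t₀) (s • v),
        Lp.coeFn_smul s v] with u h1 h2 h3 h4 h5 h6 h7 h8
      rw [hF]
      simp only [activation, derivMul] at *
      rw [h1, Pi.sub_apply, h2, Pi.smul_apply, h3, Pi.sub_apply, h4, h5, h6, h7, Pi.add_apply, h8,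
        Pi.smul_apply, smul_eq_mul, smul_eq_mul]
    have hsq : ∀ f : Signal, ‖f‖ ^ 2 = ∫ u, f u * f u := by
      intro f
      rw [← real_inner_self_eq_norm_sq, L2.inner_def]
      rfl
    have hvv : Integrable (fun u => v u * v u) volume :=
      (Lp.memLp v).integrable_mul (Lp.memLp v)
    set Φ : ℝ → unitInterval → ℝ := fun s u =>
      s⁻¹ * (σ (g t₀ u + s * v u) - σ (g t₀ u)) - deriv σ (g t₀ u) * v u with hΦ
    have hFΦ : ∀ s, ‖F s‖ ^ 2 = ∫ u, Φ s u * Φ s u := by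
      intro s
      rw [hsq]
      refine integral_congr_ae ?_
      filter_upwards [hae s] with u hu
      rw [hu]
    have hlim : Tendsto (fun s => ∫ u, Φ s u * Φ s u) (𝓝[≠] 0)
        (𝓝 (∫ _ : unitInterval, (0 : ℝ))) := by
      refine tendsto_integral_filter_of_dominated_convergence (fun u => 4 * (v u * v u)) ?_ ?_
        (hvv.const_mul 4) ?_
      · refine Eventually.of_forall fun s => ?_
        have h1 : AEStronglyMeasurable (Φ s) volume :=
          (Lp.aestronglyMeasurable (F s)).congr (hae s)
        exact h1.mul h1
      · filter_upwards [self_mem_nhdsWithin] with s hs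
        have hs0 : s ≠ 0 := hs
        refine Eventually.of_forall fun u => ?_
        have h1 : |s⁻¹ * (σ (g t₀ u + s * v u) - σ (g t₀ u))| ≤ |v u| := by
          have h2 : |σ (g t₀ u + s * v u) - σ (g t₀ u)| ≤ |s * v u| := by
            have := hσ.dist_le_mul (g t₀ u + s * v u) (g t₀ u)
            simpa [Real.dist_eq] using this
          rw [abs_mul, abs_inv, inv_mul_le_iff₀ (abs_pos.2 hs0), ← abs_mul]
          exact h2
        have h3 : |deriv σ (g t₀ u) * v u| ≤ |v u| := by
          have h4 := norm_deriv_le_of_lipschitz hσ (x₀ := g t₀ u)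
          rw [abs_mul]
          exact mul_le_of_le_one_left (abs_nonneg _) (by simpa using h4)
        have h5 : |Φ s u| ≤ 2 * |v u| := (abs_sub _ _).trans (by linarith)
        rw [Real.norm_eq_abs, abs_mul]
        nlinarith [abs_nonneg (Φ s u), abs_nonneg (v u), abs_mul_abs_self (v u)]
      · filter_upwards [hd] with u hu
        have h1 : HasDerivAt (fun s : ℝ => σ (g t₀ u + s * v u)) (deriv σ (g t₀ u) * v u) 0 := by
          have h2 : HasDerivAt (fun s : ℝ => g t₀ u + s * v u) (v u) 0 := by
            simpa using ((hasDerivAt_id (0 : ℝ)).mul_const (v u)).const_add (g t₀ u)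
          have h3 : HasDerivAt σ (deriv σ (g t₀ u)) (g t₀ u + 0 * v u) := by
            simpa using hu.hasDerivAt
          exact h3.comp (0 : ℝ) h2
        rw [hasDerivAt_iff_tendsto_slope_zero] at h1
        have h4 : Tendsto (fun s => Φ s u) (𝓝[≠] 0) (𝓝 0) := by
          have h5 := h1.sub_const (deriv σ (g t₀ u) * v u)
          simpa [hΦ] using h5
        simpa using h4.mul h4
    simp only [integral_zero] at hlim
    simp only [← hFΦ] at hlim
    rw [tendsto_zero_iff_norm_tendsto_zero]
    have h6 := hlim.sqrt
    simpa [Real.sqrt_sq (norm_nonneg _)] using h6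
  have hrem : Tendsto (fun s : ℝ =>
      s⁻¹ • (activation hσ (g (t₀ + s)) - activation hσ (g t₀ + s • v))) (𝓝[≠] 0) (𝓝 0) := by
    have h1 : Tendsto (fun s : ℝ => ‖s⁻¹ • (g (t₀ + s) - g t₀) - v‖) (𝓝[≠] 0) (𝓝 0) := by
      rw [← tendsto_iff_norm_sub_tendsto_zero]
      exact hg
    refine squeeze_zero_norm' ?_ h1
    filter_upwards [self_mem_nhdsWithin] with s hs
    have hs0 : s ≠ 0 := hs
    have h2 : s⁻¹ • (g (t₀ + s) - g t₀) - v = s⁻¹ • (g (t₀ + s) - (g t₀ + s • v)) := by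
      rw [← sub_sub, smul_sub s⁻¹ (g (t₀ + s) - g t₀), inv_smul_smul₀ hs0]
    rw [h2, norm_smul, norm_smul]
    exact mul_le_mul_of_nonneg_left (norm_activation_sub_le hσ _ _) (norm_nonneg _)
  have h7 := (hrem.add key).add_const (derivMul hσ (g t₀) v)
  rw [add_zero, zero_add] at h7
  refine h7.congr fun s => ?_
  rw [hF]
  simp only [smul_sub]
  abel

lemma layer_update_of_lt {σ : ℝ → ℝ} (hσ : LipschitzWith 1 σ) (K : ℕ) (h : ℕ → ℕ → ℝ) (W : Graphon)
    (X : Signal) {l : ℕ} (c : ℕ → ℝ) (m : ℕ) (hm : m < l) :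
    layer hσ K (Function.update h l c) W X m = layer hσ K h W X m := by
  induction m with
  | zero => rfl
  | succ m ih =>
    rw [layer, layer, ih (by omega), Function.update_of_ne (by omega)]

lemma conv_update {K k : ℕ} (hk : k < K) (c : ℕ → ℝ) (W : Graphon) (Z : Signal) (t : ℝ) :
    conv K (Function.update c k t) W Z = conv K c W Z + (t - c k) • (W.op ^ k) Z := by
  have h1 : ∀ j, Function.update c k t j • W.op ^ j
      = c j • W.op ^ j + (if j = k then (t - c k) • W.op ^ k else 0) := by
    intro j
    by_cases hj : j = k
    · subst hj
      simp [← add_smul]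
    · simp [hj]
  simp only [conv, h1, Finset.sum_add_distrib, Finset.sum_ite_eq', Finset.mem_range, hk, if_true]
  rfl

/-- `layerDeriv` is the partial derivative, in `L²([0,1])`, of the layer output in the weight
`h l k`, whenever the activation is differentiable at almost all values it is applied to. -/
theorem hasDerivAt_layer {σ : ℝ → ℝ} (hσ : LipschitzWith 1 σ) {K : ℕ} (h : ℕ → ℕ → ℝ)
    (W : Graphon) (X : Signal) {l k : ℕ} (hk : k < K) (m : ℕ)
    (hd : ∀ j ∈ Finset.Icc 1 m, ∀ᵐ u, DifferentiableAt ℝ σ (preact hσ K h W X j u)) :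
    HasDerivAt (fun t => layer hσ K (Function.update h l (Function.update (h l) k t)) W X m)
      (layerDeriv hσ K h W X l k m) (h l k) := by
  induction m with
  | zero => exact hasDerivAt_const _ _
  | succ m ih =>
    have ih' := ih fun j hj => hd j (Finset.mem_Icc.2
      ⟨(Finset.mem_Icc.1 hj).1, (Finset.mem_Icc.1 hj).2.trans (Nat.le_succ m)⟩)
    have hself : Function.update h l (Function.update (h l) k (h l k)) = h := by simp
    have hpre := hd (m + 1) (Finset.mem_Icc.2 ⟨by omega, le_rfl⟩)
    simp only [layer, layerDeriv]
    set g : ℝ → Signal := fun t =>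
      conv K (Function.update h l (Function.update (h l) k t) (m + 1)) W
        (layer hσ K (Function.update h l (Function.update (h l) k t)) W X m) with hg
    have hg0 : g (h l k) = preact hσ K h W X (m + 1) := by
      rw [hg]
      simp only [hself]
      rfl
    rw [← hg0] at hpre ⊢
    refine hasDerivAt_activation hσ ?_ hpre
    by_cases hl : m + 1 = l
    · subst hl
      rw [if_pos rfl]
      have h2 : g = fun t => conv K (h (m + 1)) W (layer hσ K h W X m)
          + (t - h (m + 1) k) • (W.op ^ k) (layer hσ K h W X m) := by
        funext t
        rw [hg]
        simp only [Function.update_self]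
        rw [layer_update_of_lt hσ K h W X _ m (Nat.lt_succ_self m), conv_update hk]
      change HasDerivAt g _ _
      rw [h2]
      have h3 := (((hasDerivAt_id (h (m + 1) k)).sub_const (h (m + 1) k)).smul_const
        ((W.op ^ k) (layer hσ K h W X m))).const_add (conv K (h (m + 1)) W (layer hσ K h W X m))
      simpa using h3
    · rw [if_neg hl]
      have h2 : g = fun t => conv K (h (m + 1)) W
          (layer hσ K (Function.update h l (Function.update (h l) k t)) W X m) := by
        funext t
        rw [hg]
        simp only [Function.update_of_ne hl]
      change HasDerivAt g _ _
      rw [h2]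
      exact (conv K (h (m + 1)) W).hasFDerivAt.comp_hasDerivAt _ ih'

end GNTK

end

open GNTK

/-!
The tangent kernel on `M` signals is a finite sum of rank-one operators `v ⊗ v`, one for each
weight, where `v` collects the derivatives of the `M` outputs in that weight; so it is compact and
self-adjoint, and its nonzero eigenvalues are those of the Gram matrix of the vectors `v`.

Relabelling the nodes acts on every layer, and on its derivatives, by the same permutation of the
cells, so it preserves the Gram matrix, hence the eigenvalues. Cut norm convergence of the graphons
gives strong convergence of the graphon operators: on the indicator of a set, the `L²` error of an
operator with kernel in `[-1, 1]` is bounded through its `L¹` error, thus by the cut norm. As the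
operators are contractions, this passes through the layers and, by dominated convergence for `σ'`,
through their derivatives, so that the tangent kernels converge in operator norm. Convergence of the
eigenvalues and of the spectral projectors is then perturbation theory of compact self-adjoint
operators.
-/

noncomputable section

namespace GNTK

section SpectralTheory

open Module.End

variable {E : Type*} [NormedAddCommGroup E] [InnerProductSpace ℝ E]

lemma mem_eigSpace {T : E →L[ℝ] E} {μ : ℝ} {x : E} : x ∈ eigSpace T μ ↔ T x = μ • x :=
  mem_eigenspace_iff

lemma eigSpace_neg (T : E →L[ℝ] E) (μ : ℝ) : eigSpace (-T) μ = eigSpace T (-μ) := by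
  ext x
  rw [mem_eigSpace, mem_eigSpace, neg_apply, neg_smul, neg_eq_iff_eq_neg]

/-- The algebraic span of the eigenspaces of `T` with eigenvalues in `S`. -/
abbrev eigSpan (T : E →L[ℝ] E) (S : Set ℝ) : Submodule ℝ E := ⨆ μ ∈ S, eigSpace T μ

lemma eigSpace_le_eigSpan (T : E →L[ℝ] E) {S : Set ℝ} {μ : ℝ} (hμ : μ ∈ S) :
    eigSpace T μ ≤ eigSpan T S :=
  le_biSup (eigSpace T) hμ

lemma eigSpan_mono (T : E →L[ℝ] E) {S S' : Set ℝ} (h : S ⊆ S') : eigSpan T S ≤ eigSpan T S' :=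
  biSup_mono fun _ hμ => h hμ

/-- The positive eigenvalues `μ` of `T` such that at least `p` eigenvalues, counted with
multiplicity, are `≥ μ`; the `p`-th positive eigenvalue is their supremum. -/
def posEigSet (T : E →L[ℝ] E) (p : ℕ) : Set ℝ :=
  {μ | 0 < μ ∧ eigSpace T μ ≠ ⊥ ∧ p ≤ Module.finrank ℝ (eigSpan T (Set.Ici μ))}

lemma posEig_eq_sSup (T : E →L[ℝ] E) (p : ℕ) : posEig T p = sSup (posEigSet T p) := rfl

lemma posEig_nonneg (T : E →L[ℝ] E) (p : ℕ) : 0 ≤ posEig T p :=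
  Real.sSup_nonneg fun _ hμ => hμ.1.le

lemma eig_of_pos (T : E →L[ℝ] E) {p : ℤ} (hp : 0 < p) : eig T p = posEig T p.toNat := if_pos hp

lemma eig_of_neg (T : E →L[ℝ] E) {p : ℤ} (hp : p < 0) : eig T p = -posEig (-T) (-p).toNat :=
  if_neg hp.not_gt

lemma exists_mem_orthogonal_ne_zero_of_finrank_lt {V V' : Submodule ℝ E} [FiniteDimensional ℝ V]
    [FiniteDimensional ℝ V'] (h : Module.finrank ℝ V' < Module.finrank ℝ V) :
    ∃ x ∈ V, x ∈ V'ᗮ ∧ x ≠ 0 := by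
  obtain ⟨x, hx, hx0⟩ := Submodule.exists_mem_ne_zero_of_ne_bot
    (((V'.orthogonalProjectionOnto : E →ₗ[ℝ] V') ∘ₗ V.subtype).ker_ne_bot_of_finrank_lt h)
  refine ⟨x, x.2, ?_, by simpa using hx0⟩
  rw [← Submodule.ker_orthogonalProjectionOnto]
  exact hx

lemma finiteDimensional_of_isCompactOperator_of_antilipschitz {V F : Type*}
    [NormedAddCommGroup V] [NormedSpace ℝ V] [CompleteSpace V] [NormedAddCommGroup F]
    [NormedSpace ℝ F] {T : V →L[ℝ] F} (hT : IsCompactOperator T) {c : NNReal}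
    (hc : AntilipschitzWith c T) : FiniteDimensional ℝ V := by
  obtain ⟨Q, hQ, hQ0⟩ := hT
  exact .of_isCompactOperator_id
    ⟨T ⁻¹' Q, (hc.isClosedEmbedding T.uniformContinuous).isCompact_preimage hQ, hQ0⟩

variable [CompleteSpace E] {T T' : E →L[ℝ] E}

instance completeSpace_eigSpace (T : E →L[ℝ] E) (μ : ℝ) : CompleteSpace (eigSpace T μ) :=
  (ContinuousLinearMap.isClosed_eigenspace T μ).completeSpace_coe

/-- The orthogonal projection `P_μ` onto the eigenspace of `T` for `μ`; it is zero when `μ` is not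
an eigenvalue, so that sums over the spectrum may be taken over all real `μ`. -/
abbrev eigProj (T : E →L[ℝ] E) (μ : ℝ) : E →L[ℝ] E := (eigSpace T μ).starProjection

lemma eigSpace_isOrtho (hs : IsSelfAdjoint T) {μ ν : ℝ} (h : μ ≠ ν) :
    eigSpace T μ ⟂ eigSpace T ν :=
  Submodule.isOrtho_iff_inner_eq.2 fun x hx y hy =>
    hs.isSymmetric.orthogonalFamily_eigenspaces h ⟨x, hx⟩ ⟨y, hy⟩

lemma eigProj_apply_map (hs : IsSelfAdjoint T) (μ : ℝ) (x : E) :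
    eigProj T μ (T x) = μ • eigProj T μ x := by
  have hx := mem_eigSpace.1 ((eigSpace T μ).starProjection_apply_mem x)
  refine Submodule.eq_starProjection_of_mem_orthogonal
    (Submodule.smul_mem _ μ ((eigSpace T μ).starProjection_apply_mem x)) ?_
  rw [← hx, ← map_sub]
  exact hs.isSymmetric.invariant_orthogonalComplement_eigenspace μ _
    ((eigSpace T μ).sub_starProjection_mem_orthogonal x)

lemma eigProj_eq_zero_of_eigSpace_eq_bot {μ : ℝ} (h : eigSpace T μ = ⊥) (x : E) :
    eigProj T μ x = 0 :=
  (Submodule.mem_bot ℝ).1 (h.le ((eigSpace T μ).starProjection_apply_mem x))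

lemma eigProj_eq_zero_of_mem_closure_eigSpan (hs : IsSelfAdjoint T) {S : Set ℝ} {x : E}
    (hx : x ∈ (eigSpan T S).topologicalClosure) {μ : ℝ} (hμ : μ ∉ S) : eigProj T μ x = 0 := by
  have hle : (eigSpan T S).topologicalClosure ≤ (eigSpace T μ)ᗮ :=
    Submodule.topologicalClosure_minimal _
      (iSup₂_le fun ν hν => eigSpace_isOrtho hs fun h => hμ (h ▸ hν))
      (Submodule.isClosed_orthogonal _)
  exact (Submodule.starProjection_apply_eq_zero_iff _).2 (hle hx)

lemma eigProj_eq_zero_of_mem_orthogonal_eigSpan {S : Set ℝ} {x : E} (hx : x ∈ (eigSpan T S)ᗮ)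
    {μ : ℝ} (hμ : μ ∈ S) : eigProj T μ x = 0 :=
  (Submodule.starProjection_apply_eq_zero_iff _).2
    (Submodule.orthogonal_le (eigSpace_le_eigSpan T hμ) hx)

lemma hasSum_eigProj (hc : IsCompactOperator T) (hs : IsSelfAdjoint T) (x : E) :
    HasSum (fun μ => eigProj T μ x) x := by
  have hsum : IsHilbertSum ℝ (fun μ => eigSpace T μ) fun μ => (eigSpace T μ).subtypeₗᵢ :=
    .mkInternal _ hs.isSymmetric.orthogonalFamily_eigenspaces <|
      (Submodule.topologicalClosure_eq_top_iff.2
        (ContinuousLinearMap.orthogonalComplement_iSup_eigenspaces_eq_bot hc hs.isSymmetric)).ge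
  have hw := hsum.hasSum_linearIsometryEquiv_symm (hsum.linearIsometryEquiv x)
  rw [LinearIsometryEquiv.symm_apply_apply] at hw
  set w := hsum.linearIsometryEquiv x
  convert hw with μ
  refine (hw.mapL (eigProj T μ)).unique ?_
  convert hasSum_single μ fun ν hν => ?_
  · exact (Submodule.starProjection_eq_self_iff.2 (w μ).2).symm
  · exact (Submodule.starProjection_apply_eq_zero_iff _).2 (eigSpace_isOrtho hs hν (w ν).2)

lemma inner_eigProj_self (T : E →L[ℝ] E) (μ : ℝ) (x : E) :
    inner ℝ x (eigProj T μ x) = ‖eigProj T μ x‖ ^ 2 := by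
  rw [real_inner_comm]
  exact (eigSpace T μ).re_inner_starProjection_eq_normSq x

lemma hasSum_norm_eigProj_sq (hc : IsCompactOperator T) (hs : IsSelfAdjoint T) (x : E) :
    HasSum (fun μ => ‖eigProj T μ x‖ ^ 2) (‖x‖ ^ 2) := by
  simpa [inner_eigProj_self] using (hasSum_eigProj hc hs x).mapL (innerSL ℝ x)

lemma hasSum_mul_norm_eigProj_sq (hc : IsCompactOperator T) (hs : IsSelfAdjoint T) (x : E) :
    HasSum (fun μ => μ * ‖eigProj T μ x‖ ^ 2) (inner ℝ x (T x)) := by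
  simpa [eigProj_apply_map hs, inner_smul_right, inner_eigProj_self]
    using (hasSum_eigProj hc hs (T x)).mapL (innerSL ℝ x)

lemma hasSum_sub_sq_mul_norm_eigProj_sq (hc : IsCompactOperator T) (hs : IsSelfAdjoint T)
    (ν : ℝ) (x : E) :
    HasSum (fun μ => (μ - ν) ^ 2 * ‖eigProj T μ x‖ ^ 2) (‖T x - ν • x‖ ^ 2) := by
  convert hasSum_norm_eigProj_sq hc hs (T x - ν • x) using 2 with μ
  rw [map_sub, map_smul, eigProj_apply_map hs, ← sub_smul, norm_smul, mul_pow, Real.norm_eq_abs,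
    sq_abs]

lemma mul_norm_sq_le_inner (hc : IsCompactOperator T) (hs : IsSelfAdjoint T) {c : ℝ} {x : E}
    (hx : x ∈ eigSpan T (Set.Ici c)) : c * ‖x‖ ^ 2 ≤ inner ℝ x (T x) := by
  refine hasSum_le (fun μ => ?_) ((hasSum_norm_eigProj_sq hc hs x).mul_left c)
    (hasSum_mul_norm_eigProj_sq hc hs x)
  by_cases hμ : c ≤ μ
  · gcongr
  · simp [eigProj_eq_zero_of_mem_closure_eigSpan hs (Submodule.le_topologicalClosure _ hx) hμ]

lemma inner_lt_mul_norm_sq (hc : IsCompactOperator T) (hs : IsSelfAdjoint T) {c : ℝ} {x : E}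
    (hx : x ∈ (eigSpan T (Set.Ici c))ᗮ) (hx0 : x ≠ 0) : inner ℝ x (T x) < c * ‖x‖ ^ 2 := by
  obtain ⟨ν, hν⟩ : ∃ ν, eigProj T ν x ≠ 0 := by
    by_contra! h
    exact hx0 ((hasSum_eigProj hc hs x).unique (by simp [h, hasSum_zero]))
  have hzero : ∀ μ, c ≤ μ → eigProj T μ x = 0 := fun μ hμ =>
    eigProj_eq_zero_of_mem_orthogonal_eigSpan hx hμ
  refine hasSum_lt (i := ν) (fun μ => ?_) ?_ (hasSum_mul_norm_eigProj_sq hc hs x)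
    ((hasSum_norm_eigProj_sq hc hs x).mul_left c)
  · rcases le_total c μ with hμ | hμ
    · simp [hzero μ hμ]
    · dsimp only
      gcongr
  · have hνc : ν < c := not_le.1 fun h => hν (hzero ν h)
    have := norm_pos_iff.2 hν
    gcongr

lemma norm_map_sub_smul_le (hc : IsCompactOperator T) (hs : IsSelfAdjoint T) {S : Set ℝ}
    {ν η : ℝ} (hη : 0 ≤ η) (hS : ∀ μ ∈ S, |μ - ν| ≤ η) {x : E}
    (hx : x ∈ (eigSpan T S).topologicalClosure) : ‖T x - ν • x‖ ≤ η * ‖x‖ := by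
  refine le_of_sq_le_sq ?_ (by positivity)
  rw [mul_pow]
  refine hasSum_le (fun μ => ?_) (hasSum_sub_sq_mul_norm_eigProj_sq hc hs ν x)
    ((hasSum_norm_eigProj_sq hc hs x).mul_left (η ^ 2))
  by_cases hμ : μ ∈ S
  · have := sq_le_sq.2 ((hS μ hμ).trans (le_abs_self η))
    gcongr
  · simp [eigProj_eq_zero_of_mem_closure_eigSpan hs hx hμ]

lemma mul_norm_le_norm_map_sub_smul (hc : IsCompactOperator T) (hs : IsSelfAdjoint T)
    {ν δ : ℝ} (hδ : 0 ≤ δ) {x : E} (hx : ∀ μ, eigProj T μ x ≠ 0 → δ ≤ |μ - ν|) :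
    δ * ‖x‖ ≤ ‖T x - ν • x‖ := by
  refine le_of_sq_le_sq ?_ (norm_nonneg _)
  rw [mul_pow]
  refine hasSum_le (fun μ => ?_) ((hasSum_norm_eigProj_sq hc hs x).mul_left (δ ^ 2))
    (hasSum_sub_sq_mul_norm_eigProj_sq hc hs ν x)
  by_cases hμ : eigProj T μ x = 0
  · simp [hμ]
  · have := sq_le_sq.2 ((abs_of_nonneg hδ).trans_le (hx μ hμ))
    gcongr

lemma finiteDimensional_eigSpan (hc : IsCompactOperator T) (hs : IsSelfAdjoint T) {S : Set ℝ}
    {c : ℝ} (hc0 : 0 < c) (hS : ∀ μ ∈ S, c ≤ |μ|) : FiniteDimensional ℝ (eigSpan T S) := by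
  let V := (eigSpan T S).topologicalClosure
  have hbelow : ∀ x : V, ‖x‖ ≤ c⁻¹ * ‖(T ∘L V.subtypeL) x‖ := fun x => by
    have hx : ∀ μ, eigProj T μ (x : E) ≠ 0 → c ≤ |μ - 0| := fun μ hμ => by
      rw [sub_zero]
      exact hS μ (by_contra fun h => hμ (eigProj_eq_zero_of_mem_closure_eigSpan hs x.2 h))
    have := mul_norm_le_norm_map_sub_smul hc hs hc0.le hx
    rw [le_inv_mul_iff₀ hc0]
    simpa using this
  have : FiniteDimensional ℝ V := finiteDimensional_of_isCompactOperator_of_antilipschitz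
    (hc.comp_clm V.subtypeL)
    (ContinuousLinearMap.antilipschitz_of_bound (K := ⟨c⁻¹, by positivity⟩) _ hbelow)
  exact Submodule.finiteDimensional_of_le (Submodule.le_topologicalClosure _)

lemma finite_eigenvalues (hc : IsCompactOperator T) (hs : IsSelfAdjoint T) {S : Set ℝ}
    {c : ℝ} (hc0 : 0 < c) (hS : ∀ μ ∈ S, c ≤ |μ|) : {μ ∈ S | eigSpace T μ ≠ ⊥}.Finite := by
  have := finiteDimensional_eigSpan hc hs hc0 hS
  choose! v hv hv0 using fun μ (hμ : eigSpace T μ ≠ ⊥) => Submodule.exists_mem_ne_zero_of_ne_bot hμ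
  have hli : LinearIndependent ℝ fun μ : {μ ∈ S | eigSpace T μ ≠ ⊥} => v μ :=
    eigenvectors_linearIndependent' (T : E →ₗ[ℝ] E) Subtype.val Subtype.val_injective _
      fun μ => ⟨hv μ μ.2.2, hv0 μ μ.2.2⟩
  have hmem : ∀ μ : {μ ∈ S | eigSpace T μ ≠ ⊥}, v μ ∈ eigSpan T S := fun μ =>
    eigSpace_le_eigSpan T μ.2.1 (hv μ μ.2.2)
  have hli' : LinearIndependent ℝ
      fun μ : {μ ∈ S | eigSpace T μ ≠ ⊥} => (⟨v μ, hmem μ⟩ : eigSpan T S) :=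
    .of_comp (eigSpan T S).subtype hli
  have := hli'.finite
  exact Set.toFinite _

lemma finiteDimensional_eigSpan_Ici (hc : IsCompactOperator T) (hs : IsSelfAdjoint T) {c : ℝ}
    (hc0 : 0 < c) : FiniteDimensional ℝ (eigSpan T (Set.Ici c)) :=
  finiteDimensional_eigSpan hc hs hc0 fun _ hμ => le_abs.2 (.inl hμ)

lemma isGreatest_posEig (hc : IsCompactOperator T) (hs : IsSelfAdjoint T) {p : ℕ}
    (hne : (posEigSet T p).Nonempty) : IsGreatest (posEigSet T p) (posEig T p) := by
  obtain ⟨c, hcA⟩ := hne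
  have hfin : (posEigSet T p ∩ Set.Ici c).Finite :=
    (finite_eigenvalues hc hs (S := Set.Ici c) hcA.1 fun _ hμ => le_abs.2 (.inl hμ)).subset
      fun μ hμ => ⟨hμ.2, hμ.1.2.1⟩
  obtain ⟨m, ⟨hmA, hcm⟩, hmax⟩ := Set.exists_max_image _ id hfin ⟨c, hcA, Set.mem_Ici.2 le_rfl⟩
  have hgreatest : IsGreatest (posEigSet T p) m := ⟨hmA, fun μ hμ =>
    (le_total μ c).elim (fun hμc => hμc.trans hcm) fun hcμ => hmax μ ⟨hμ, hcμ⟩⟩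
  rwa [posEig_eq_sSup, hgreatest.csSup_eq]

lemma exists_isLeast_eigenvalues_Ici (hc : IsCompactOperator T) (hs : IsSelfAdjoint T) {c : ℝ}
    (hc0 : 0 < c) (hne : eigSpan T (Set.Ici c) ≠ ⊥) :
    ∃ m, c ≤ m ∧ eigSpace T m ≠ ⊥ ∧ eigSpan T (Set.Ici c) ≤ eigSpan T (Set.Ici m) := by
  obtain ⟨m, ⟨hcm, hm⟩, hmin⟩ := Set.exists_min_image {μ ∈ Set.Ici c | eigSpace T μ ≠ ⊥} id
    (finite_eigenvalues hc hs hc0 fun _ hμ => le_abs.2 (.inl hμ)) <| by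
      by_contra! h
      refine hne (le_bot_iff.1 (iSup₂_le fun μ hμ => le_bot_iff.2 ?_))
      by_contra hμ'
      exact (h ▸ Set.notMem_empty μ) ⟨hμ, hμ'⟩
  refine ⟨m, hcm, hm, iSup₂_le fun μ hμ => ?_⟩
  by_cases hμ' : eigSpace T μ = ⊥
  · simp [hμ']
  · exact eigSpace_le_eigSpan T (hmin μ ⟨hμ, hμ'⟩)

lemma finrank_eigSpan_Ici_anti (hc : IsCompactOperator T) (hs : IsSelfAdjoint T) {c d : ℝ}
    (hc0 : 0 < c) (hcd : c ≤ d) :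
    Module.finrank ℝ (eigSpan T (Set.Ici d)) ≤ Module.finrank ℝ (eigSpan T (Set.Ici c)) :=
  have := finiteDimensional_eigSpan_Ici hc hs hc0
  Submodule.finrank_mono (eigSpan_mono T (Set.Ici_subset_Ici.2 hcd))

lemma posEig_mem (hc : IsCompactOperator T) (hs : IsSelfAdjoint T) {p : ℕ}
    (h : 0 < posEig T p) :
    eigSpace T (posEig T p) ≠ ⊥ ∧ p ≤ Module.finrank ℝ (eigSpan T (Set.Ici (posEig T p))) := by
  refine (isGreatest_posEig hc hs ?_).1.2
  by_contra! hempty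
  rw [posEig_eq_sSup, hempty, Real.sSup_empty] at h
  exact h.false

lemma le_posEig_iff (hc : IsCompactOperator T) (hs : IsSelfAdjoint T) {c : ℝ} (hc0 : 0 < c)
    {p : ℕ} (hp : p ≠ 0) :
    c ≤ posEig T p ↔ p ≤ Module.finrank ℝ (eigSpan T (Set.Ici c)) := by
  refine ⟨fun h => (posEig_mem hc hs (hc0.trans_le h)).2.trans
    (finrank_eigSpan_Ici_anti hc hs hc0 h), fun h => ?_⟩
  obtain ⟨m, hcm, hm, hle⟩ := exists_isLeast_eigenvalues_Ici hc hs hc0 fun hbot => hp <| by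
    rwa [hbot, finrank_bot, Nat.le_zero] at h
  have hm0 := hc0.trans_le hcm
  have := finiteDimensional_eigSpan_Ici hc hs hm0
  have hmem : m ∈ posEigSet T p := ⟨hm0, hm, h.trans (Submodule.finrank_mono hle)⟩
  exact hcm.trans ((isGreatest_posEig hc hs ⟨m, hmem⟩).2 hmem)

lemma exists_posEig_eq (hc : IsCompactOperator T) (hs : IsSelfAdjoint T) {μ : ℝ} (hμ0 : 0 < μ)
    (hμ : eigSpace T μ ≠ ⊥) : ∃ p ≠ 0, posEig T p = μ := by
  have := finiteDimensional_eigSpan_Ici hc hs hμ0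
  have hle : eigSpace T μ ≤ eigSpan T (Set.Ici μ) := eigSpace_le_eigSpan T Set.self_mem_Ici
  set p := Module.finrank ℝ (eigSpan T (Set.Ici μ))
  have hp0 : p ≠ 0 := fun h => hμ (le_bot_iff.1 (Submodule.finrank_eq_zero.1 h ▸ hle))
  have hge : μ ≤ posEig T p := (le_posEig_iff hc hs hμ0 hp0).2 le_rfl
  refine ⟨p, hp0, hge.antisymm' (le_of_not_gt fun hlt => hμ ?_)⟩
  have hspan : eigSpan T (Set.Ici (posEig T p)) = eigSpan T (Set.Ici μ) :=
    Submodule.eq_of_le_of_finrank_le (eigSpan_mono T (Set.Ici_subset_Ici.2 hge))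
      (posEig_mem hc hs (hμ0.trans hlt)).2
  refine le_bot_iff.1 fun x hx => ?_
  have hzero := eigProj_eq_zero_of_mem_closure_eigSpan hs
    (Submodule.le_topologicalClosure _ (hspan ▸ hle hx)) (Set.notMem_Ici.2 hlt)
  rwa [eigProj, Submodule.starProjection_eq_self_iff.2 hx] at hzero

lemma finrank_eigSpan_Ici_le_of_norm_sub_le (hc : IsCompactOperator T) (hs : IsSelfAdjoint T)
    (hc' : IsCompactOperator T') (hs' : IsSelfAdjoint T') {c c' : ℝ} (hc0 : 0 < c')
    (h : ‖T - T'‖ ≤ c - c') :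
    Module.finrank ℝ (eigSpan T (Set.Ici c)) ≤ Module.finrank ℝ (eigSpan T' (Set.Ici c')) := by
  have hcc : c' ≤ c := sub_nonneg.1 ((norm_nonneg _).trans h)
  have := finiteDimensional_eigSpan_Ici hc hs (hc0.trans_le hcc)
  have := finiteDimensional_eigSpan_Ici hc' hs' hc0
  by_contra! hlt
  obtain ⟨x, hx, hx', hx0⟩ := exists_mem_orthogonal_ne_zero_of_finrank_lt hlt
  have hdiff : inner ℝ x ((T - T') x) ≤ (c - c') * ‖x‖ ^ 2 := calc
    inner ℝ x ((T - T') x) ≤ ‖x‖ * ‖(T - T') x‖ := real_inner_le_norm _ _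
    _ ≤ ‖x‖ * ((c - c') * ‖x‖) := by gcongr; exact (T - T').le_of_opNorm_le h x
    _ = (c - c') * ‖x‖ ^ 2 := by ring
  rw [sub_apply, inner_sub_right] at hdiff
  linarith [mul_norm_sq_le_inner hc hs hx, inner_lt_mul_norm_sq hc' hs' hx' hx0]

lemma posEig_le_add_norm_sub (hc : IsCompactOperator T) (hs : IsSelfAdjoint T)
    (hc' : IsCompactOperator T') (hs' : IsSelfAdjoint T') {p : ℕ} (hp : p ≠ 0) :
    posEig T p ≤ posEig T' p + ‖T - T'‖ := by
  by_contra! h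
  have hpos : 0 < posEig T p - ‖T - T'‖ := by linarith [posEig_nonneg T' p]
  have hrank := finrank_eigSpan_Ici_le_of_norm_sub_le hc hs hc' hs' hpos
    (c := posEig T p) (by linarith)
  have := (le_posEig_iff hc' hs' hpos hp).2
    ((posEig_mem hc hs (by linarith [norm_nonneg (T - T')])).2.trans hrank)
  linarith

lemma abs_posEig_sub_le (hc : IsCompactOperator T) (hs : IsSelfAdjoint T)
    (hc' : IsCompactOperator T') (hs' : IsSelfAdjoint T') {p : ℕ} (hp : p ≠ 0) :
    |posEig T p - posEig T' p| ≤ ‖T - T'‖ := by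
  have h := posEig_le_add_norm_sub hc hs hc' hs' hp
  have h' := posEig_le_add_norm_sub hc' hs' hc hs hp
  rw [norm_sub_rev] at h'
  exact abs_sub_le_iff.2 ⟨by linarith, by linarith⟩

lemma abs_eig_sub_le (hc : IsCompactOperator T) (hs : IsSelfAdjoint T)
    (hc' : IsCompactOperator T') (hs' : IsSelfAdjoint T') {p : ℤ} (hp : p ≠ 0) :
    |eig T p - eig T' p| ≤ ‖T - T'‖ := by
  rcases hp.lt_or_gt with hneg | hpos
  · rw [eig_of_neg T hneg, eig_of_neg T' hneg, neg_sub_neg, abs_sub_comm]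
    refine (abs_posEig_sub_le hc.neg hs.neg hc'.neg hs'.neg (by lia)).trans_eq ?_
    rw [neg_sub_neg, norm_sub_rev]
  · rw [eig_of_pos T hpos, eig_of_pos T' hpos]
    exact abs_posEig_sub_le hc hs hc' hs' (by lia)

lemma eigSpace_eig_ne_bot (hc : IsCompactOperator T) (hs : IsSelfAdjoint T) {p : ℤ} (hp : p ≠ 0)
    (h : eig T p ≠ 0) : eigSpace T (eig T p) ≠ ⊥ := by
  rcases hp.lt_or_gt with hneg | hpos
  · rw [eig_of_neg T hneg] at h ⊢
    rw [← eigSpace_neg]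
    exact (posEig_mem hc.neg hs.neg ((posEig_nonneg _ _).lt_of_ne' (neg_ne_zero.1 h))).1
  · rw [eig_of_pos T hpos] at h ⊢
    exact (posEig_mem hc hs ((posEig_nonneg _ _).lt_of_ne' h)).1

lemma exists_eig_eq (hc : IsCompactOperator T) (hs : IsSelfAdjoint T) {μ : ℝ} (hμ0 : μ ≠ 0)
    (hμ : eigSpace T μ ≠ ⊥) : ∃ p ≠ 0, eig T p = μ := by
  rcases hμ0.lt_or_gt with hneg | hpos
  · obtain ⟨p, hp, hpμ⟩ := exists_posEig_eq hc.neg hs.neg (neg_pos.2 hneg)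
      (by rwa [eigSpace_neg, neg_neg])
    refine ⟨-p, by simpa using hp, ?_⟩
    rw [eig_of_neg T (by lia), neg_neg, Int.toNat_natCast, hpμ, neg_neg]
  · obtain ⟨p, hp, hpμ⟩ := exists_posEig_eq hc hs hpos hμ
    exact ⟨p, by simpa using hp, by rw [eig_of_pos T (by lia), Int.toNat_natCast, hpμ]⟩

lemma tendsto_eig {ι : Type*} {l : Filter ι} {F : ι → E →L[ℝ] E}
    (hFc : ∀ i, IsCompactOperator (F i)) (hFs : ∀ i, IsSelfAdjoint (F i))
    (hc : IsCompactOperator T) (hs : IsSelfAdjoint T) (hF : Tendsto F l (𝓝 T)) {p : ℤ}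
    (hp : p ≠ 0) : Tendsto (fun i => eig (F i) p) l (𝓝 (eig T p)) :=
  tendsto_iff_dist_tendsto_zero.2 <| squeeze_zero (fun _ => dist_nonneg)
    (fun i => abs_eig_sub_le (hFc i) (hFs i) hc hs hp) (tendsto_iff_norm_sub_tendsto_zero.1 hF)

lemma norm_starProjection_sub_le {V V' : Submodule ℝ E} [V.HasOrthogonalProjection]
    [V'.HasOrthogonalProjection] {κ : ℝ} (hκ : 0 ≤ κ)
    (h : ∀ x ∈ V, ‖x - V'.starProjection x‖ ≤ κ * ‖x‖)
    (h' : ∀ x ∈ V', ‖x - V.starProjection x‖ ≤ κ * ‖x‖) :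
    ‖V'.starProjection - V.starProjection‖ ≤ 2 * κ := by
  have key : ∀ (U U' : Submodule ℝ E) [U.HasOrthogonalProjection] [U'.HasOrthogonalProjection],
      (∀ x ∈ U, ‖x - U'.starProjection x‖ ≤ κ * ‖x‖) →
        ‖(1 - U'.starProjection) * U.starProjection‖ ≤ κ := fun U U' _ _ hU =>
    ContinuousLinearMap.opNorm_le_bound _ hκ fun z => (hU _ (U.starProjection_apply_mem z)).trans
      (mul_le_mul_of_nonneg_left (U.norm_starProjection_apply_le z) hκ)
  have hadj : ‖V'.starProjection * (1 - V.starProjection)‖ ≤ κ := by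
    rw [← norm_star, star_mul, star_sub, star_one,
      (isSelfAdjoint_starProjection V).star_eq, (isSelfAdjoint_starProjection V').star_eq]
    exact key V' V h'
  calc ‖V'.starProjection - V.starProjection‖
      = ‖V'.starProjection * (1 - V.starProjection)
          - (1 - V'.starProjection) * V.starProjection‖ := by noncomm_ring
    _ ≤ κ + κ := (norm_sub_le _ _).trans (add_le_add hadj (key V V' h))
    _ = 2 * κ := (two_mul κ).symm

lemma mul_norm_sub_spectralProj_le (hc : IsCompactOperator T) (hs : IsSelfAdjoint T) {S : Set ℝ}
    {ν δ : ℝ} (hδ : 0 ≤ δ) (hS : ∀ μ, eigSpace T μ ≠ ⊥ → μ ∉ S → δ ≤ |μ - ν|) (x : E) :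
    δ * ‖x - spectralProj T S x‖ ≤ ‖T x - ν • x‖ := by
  set y := x - spectralProj T S x
  have hin : ∀ μ ∈ S, eigProj T μ y = 0 := fun μ hμ =>
    eigProj_eq_zero_of_mem_orthogonal_eigSpan (Submodule.orthogonal_le
      (Submodule.le_topologicalClosure _) (Submodule.sub_starProjection_mem_orthogonal x)) hμ
  have hout : ∀ μ ∉ S, eigProj T μ y = eigProj T μ x := fun μ hμ => by
    have hP : spectralProj T S x ∈ (eigSpan T S).topologicalClosure :=
      Submodule.starProjection_apply_mem _ x
    rw [map_sub, eigProj_eq_zero_of_mem_closure_eigSpan hs hP hμ, sub_zero]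
  refine le_of_sq_le_sq ?_ (norm_nonneg _)
  rw [mul_pow]
  refine hasSum_le (fun μ => ?_) ((hasSum_norm_eigProj_sq hc hs y).mul_left (δ ^ 2))
    (hasSum_sub_sq_mul_norm_eigProj_sq hc hs ν x)
  by_cases hμ : μ ∈ S
  · rw [hin μ hμ, norm_zero, zero_pow two_ne_zero, mul_zero]
    positivity
  rw [hout μ hμ]
  by_cases hbot : eigSpace T μ = ⊥
  · simp [eigProj_eq_zero_of_eigSpace_eq_bot hbot]
  · have := sq_le_sq.2 ((abs_of_nonneg hδ).trans_le (hS μ hbot hμ))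
    gcongr

lemma norm_spectralProj_sub_le (hc : IsCompactOperator T) (hs : IsSelfAdjoint T)
    (hc' : IsCompactOperator T') (hs' : IsSelfAdjoint T') {S S' : Set ℝ} {ν δ η : ℝ}
    (hδ : 0 < δ) (hη : 0 ≤ η) (hS : ∀ μ ∈ S, |μ - ν| ≤ η) (hS' : ∀ μ ∈ S', |μ - ν| ≤ η)
    (hgap : ∀ μ, eigSpace T μ ≠ ⊥ → μ ∉ S → δ ≤ |μ - ν|)
    (hgap' : ∀ μ, eigSpace T' μ ≠ ⊥ → μ ∉ S' → δ ≤ |μ - ν|) :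
    ‖spectralProj T' S' - spectralProj T S‖ ≤ 2 * ((η + ‖T - T'‖) / δ) := by
  have near : ∀ (A B : E →L[ℝ] E) (x : E), ‖A x - ν • x‖ ≤ η * ‖x‖ →
      ‖B x - ν • x‖ ≤ (η + ‖A - B‖) * ‖x‖ := fun A B x hx => calc
    ‖B x - ν • x‖ = ‖(A x - ν • x) - (A - B) x‖ := by rw [sub_apply]; abel_nf
    _ ≤ η * ‖x‖ + ‖A - B‖ * ‖x‖ := (norm_sub_le _ _).trans (add_le_add hx ((A - B).le_opNorm x))
    _ = (η + ‖A - B‖) * ‖x‖ := (add_mul _ _ _).symm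
  refine norm_starProjection_sub_le (by positivity) (fun x hx => ?_) fun x hx => ?_
  · rw [div_mul_eq_mul_div, le_div_iff₀' hδ]
    exact (mul_norm_sub_spectralProj_le hc' hs' hδ.le hgap' x).trans
      (near T T' x (norm_map_sub_smul_le hc hs hη hS hx))
  · rw [div_mul_eq_mul_div, le_div_iff₀' hδ, norm_sub_rev T]
    exact (mul_norm_sub_spectralProj_le hc hs hδ.le hgap x).trans
      (near T' T x (norm_map_sub_smul_le hc' hs' hη hS' hx))

lemma exists_gap (hc : IsCompactOperator T) (hs : IsSelfAdjoint T) {ν : ℝ} (hν : ν ≠ 0) :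
    ∃ δ > 0, δ ≤ |ν| ∧ ∀ μ, eigSpace T μ ≠ ⊥ → μ ≠ ν → δ ≤ |μ - ν| := by
  have hν0 : 0 < |ν| / 2 := by positivity
  have hfin := (finite_eigenvalues hc hs (S := {μ | |ν| / 2 ≤ |μ| ∧ μ ≠ ν}) hν0 fun _ hμ => hμ.1)
  obtain ⟨δ, hδ, hball⟩ := Metric.isOpen_iff.1 hfin.isClosed.isOpen_compl ν fun h => h.1.2 rfl
  refine ⟨min δ (|ν| / 2), lt_min hδ hν0, (min_le_right _ _).trans (half_le_self (abs_nonneg ν)),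
    fun μ hμ hne => ?_⟩
  by_cases hlarge : |ν| / 2 ≤ |μ|
  · exact (min_le_left _ _).trans (not_lt.1 fun h => hball h ⟨⟨hlarge, hne⟩, hμ⟩)
  · refine (min_le_right _ _).trans ?_
    linarith [abs_sub_abs_le_abs_sub ν μ, abs_sub_comm ν μ]

lemma norm_spectralProj_eig_sub_le (hc : IsCompactOperator T) (hs : IsSelfAdjoint T)
    (hc' : IsCompactOperator T') (hs' : IsSelfAdjoint T') {ν δ : ℝ} (hδ : 0 < δ)
    (hδν : δ ≤ |ν|) (hgap : ∀ μ, eigSpace T μ ≠ ⊥ → μ ≠ ν → δ ≤ |μ - ν|)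
    (hT : ‖T - T'‖ ≤ δ / 2) :
    ‖spectralProj T' (eig T' '' {q | q ≠ 0 ∧ eig T q = ν}) - spectralProj T {ν}‖
      ≤ 8 / δ * ‖T - T'‖ := by
  have hclose : ∀ q ≠ 0, |eig T q - eig T' q| ≤ ‖T - T'‖ := fun q => abs_eig_sub_le hc hs hc' hs'
  have hbound := norm_spectralProj_sub_le hc hs hc' hs' (S := {ν})
    (S' := eig T' '' {q | q ≠ 0 ∧ eig T q = ν}) (half_pos hδ) (norm_nonneg (T - T')) (ν := ν)
    (by simp) ?_ (fun μ hμ hne => (half_le_self hδ.le).trans (hgap μ hμ hne)) ?_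
  · calc _ ≤ _ := hbound
      _ = 8 / δ * ‖T - T'‖ := by ring
  · rintro _ ⟨q, ⟨hq, rfl⟩, rfl⟩
    rw [abs_sub_comm]
    exact hclose q hq
  · intro μ hμ hμS
    rcases eq_or_ne μ 0 with rfl | hμ0
    · rw [zero_sub, abs_neg]
      linarith
    obtain ⟨q, hq, rfl⟩ := exists_eig_eq hc' hs' hμ0 hμ
    have hqν : eig T q ≠ ν := fun h => hμS ⟨q, ⟨hq, h⟩, rfl⟩
    have hfar : δ ≤ |eig T q - ν| := by
      rcases eq_or_ne (eig T q) 0 with h0 | h0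
      · rwa [h0, zero_sub, abs_neg]
      · exact hgap _ (eigSpace_eig_ne_bot hc hs hq h0) hqν
    linarith [abs_sub_le (eig T q) (eig T' q) ν, hclose q hq]

lemma tendsto_spectralProj {ι : Type*} {l : Filter ι} {F : ι → E →L[ℝ] E}
    (hFc : ∀ i, IsCompactOperator (F i)) (hFs : ∀ i, IsSelfAdjoint (F i))
    (hc : IsCompactOperator T) (hs : IsSelfAdjoint T) (hF : Tendsto F l (𝓝 T)) {ν : ℝ}
    (hν : ν ≠ 0) :
    Tendsto (fun i => spectralProj (F i) (eig (F i) '' {q | q ≠ 0 ∧ eig T q = ν})) l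
      (𝓝 (spectralProj T {ν})) := by
  obtain ⟨δ, hδ, hδν, hgap⟩ := exists_gap hc hs hν
  have hnorm : Tendsto (fun i => ‖T - F i‖) l (𝓝 0) := by
    simpa only [norm_sub_rev] using tendsto_iff_norm_sub_tendsto_zero.1 hF
  rw [tendsto_iff_norm_sub_tendsto_zero]
  refine squeeze_zero' (.of_forall fun _ => norm_nonneg _) ?_
    (by simpa using hnorm.const_mul (8 / δ))
  filter_upwards [hnorm.eventually_le_const (half_pos hδ)] with i hi
  exact norm_spectralProj_eig_sub_le hc hs (hFc i) (hFs i) hδ hδν hgap hi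

section Intertwining

variable {E' : Type*} [NormedAddCommGroup E'] [InnerProductSpace ℝ E'] [CompleteSpace E']
  {T' : E' →L[ℝ] E'}

lemma finrank_eigSpan_Ici_le_of_intertwining (hc : IsCompactOperator T) (hs : IsSelfAdjoint T)
    (hc' : IsCompactOperator T') (hs' : IsSelfAdjoint T') {B : E →L[ℝ] E'} (hB : B ∘L T = T' ∘L B)
    (hker : ∀ x, B x = 0 → T x = 0) {c : ℝ} (hc0 : 0 < c) :
    Module.finrank ℝ (eigSpan T (Set.Ici c)) ≤ Module.finrank ℝ (eigSpan T' (Set.Ici c)) := by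
  have := finiteDimensional_eigSpan_Ici hc' hs' hc0
  have hmaps : eigSpan T (Set.Ici c) ≤ (eigSpan T' (Set.Ici c)).comap (B : E →ₗ[ℝ] E') :=
    iSup₂_le fun μ hμ x hx => eigSpace_le_eigSpan T' hμ <| mem_eigSpace.2 <| calc
      T' (B x) = B (T x) := (DFunLike.congr_fun hB x).symm
      _ = μ • B x := by rw [mem_eigSpace.1 hx, map_smul]
  refine LinearMap.finrank_le_finrank_of_injective
    (f := (B : E →ₗ[ℝ] E').restrict hmaps) ((injective_iff_map_eq_zero _).2 fun x hx => ?_)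
  have hTx : T x = 0 := hker x (congrArg Subtype.val hx)
  have hx0 := mul_norm_sq_le_inner hc hs x.2
  rw [hTx, inner_zero_right] at hx0
  have : ‖(x : E)‖ ^ 2 ≤ 0 := nonpos_of_mul_nonpos_right hx0 hc0
  simpa using this

lemma posEig_eq_of_intertwining (hc : IsCompactOperator T) (hs : IsSelfAdjoint T)
    (hc' : IsCompactOperator T') (hs' : IsSelfAdjoint T') {B : E →L[ℝ] E'} {B' : E' →L[ℝ] E}
    (hB : B ∘L T = T' ∘L B) (hker : ∀ x, B x = 0 → T x = 0)
    (hB' : B' ∘L T' = T ∘L B') (hker' : ∀ x, B' x = 0 → T' x = 0) {p : ℕ} (hp : p ≠ 0) :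
    posEig T p = posEig T' p := by
  have hrank : ∀ c > 0, Module.finrank ℝ (eigSpan T (Set.Ici c))
      = Module.finrank ℝ (eigSpan T' (Set.Ici c)) := fun c hc0 =>
    (finrank_eigSpan_Ici_le_of_intertwining hc hs hc' hs' hB hker hc0).antisymm
      (finrank_eigSpan_Ici_le_of_intertwining hc' hs' hc hs hB' hker' hc0)
  refine eq_of_forall_le_iff fun c => ?_
  rcases le_or_gt c 0 with hc0 | hc0
  · simp only [hc0.trans (posEig_nonneg _ _)]
  · rw [le_posEig_iff hc hs hc0 hp, le_posEig_iff hc' hs' hc0 hp, hrank c hc0]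

lemma eig_eq_of_intertwining (hc : IsCompactOperator T) (hs : IsSelfAdjoint T)
    (hc' : IsCompactOperator T') (hs' : IsSelfAdjoint T') {B : E →L[ℝ] E'} {B' : E' →L[ℝ] E}
    (hB : B ∘L T = T' ∘L B) (hker : ∀ x, B x = 0 → T x = 0)
    (hB' : B' ∘L T' = T ∘L B') (hker' : ∀ x, B' x = 0 → T' x = 0) {p : ℤ} (hp : p ≠ 0) :
    eig T p = eig T' p := by
  rcases hp.lt_or_gt with hneg | hpos
  · rw [eig_of_neg T hneg, eig_of_neg T' hneg, posEig_eq_of_intertwining (B := B) (B' := B')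
      hc.neg hs.neg hc'.neg hs'.neg]
    · rw [ContinuousLinearMap.comp_neg, ContinuousLinearMap.neg_comp, hB]
    · simpa using hker
    · rw [ContinuousLinearMap.comp_neg, ContinuousLinearMap.neg_comp, hB']
    · simpa using hker'
    · lia
  · rw [eig_of_pos T hpos, eig_of_pos T' hpos]
    exact posEig_eq_of_intertwining hc hs hc' hs' hB hker hB' hker' (by lia)

end Intertwining

end SpectralTheory

section SumRankOne

open InnerProductSpace

variable {E E' : Type*} [NormedAddCommGroup E] [InnerProductSpace ℝ E] [NormedAddCommGroup E']
  [InnerProductSpace ℝ E'] {ι : Type*} {s : Finset ι}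

lemma isCompactOperator_rankOne (v : E) (w : E') : IsCompactOperator (rankOne ℝ v w) := by
  have hid : IsCompactOperator (id : ℝ → ℝ) :=
    (isCompactOperator_id_iff_finiteDimensional (𝕜 := ℝ)).2 inferInstance
  rw [rankOne_def']
  exact (hid.comp_clm (innerSL ℝ w)).clm_comp (ContinuousLinearMap.toSpanSingleton ℝ v)

lemma isCompactOperator_sum_rankOne (s : Finset ι) (v : ι → E) (w : ι → E') :
    IsCompactOperator (∑ a ∈ s, rankOne ℝ (v a) (w a) : E' →L[ℝ] E) :=
  Submodule.sum_mem (compactOperator (RingHom.id ℝ) E' E) fun a _ =>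
    isCompactOperator_rankOne (v a) (w a)

lemma isSelfAdjoint_sum_rankOne [CompleteSpace E] (s : Finset ι) (v : ι → E) :
    IsSelfAdjoint (∑ a ∈ s, rankOne ℝ (v a) (v a)) :=
  isSelfAdjoint_sum s fun a _ => (isPositive_rankOne_self (𝕜 := ℝ) (v a)).isSelfAdjoint

lemma sum_rankOne_apply (s : Finset ι) (v : ι → E) (w : ι → E') (x : E') :
    (∑ a ∈ s, rankOne ℝ (v a) (w a)) x = ∑ a ∈ s, inner ℝ (w a) x • v a := by
  simp only [sum_apply, rankOne_apply]

section Gram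

variable {v : ι → E} {w : ι → E'}
  (h : ∀ a ∈ s, ∀ b ∈ s, inner ℝ (v a) (v b) = inner ℝ (w a) (w b))

include h

lemma inner_sum_rankOne_of_gram_eq {a : ι} (ha : a ∈ s) (x : E) :
    inner ℝ (w a) ((∑ b ∈ s, rankOne ℝ (w b) (v b)) x)
      = inner ℝ (v a) ((∑ b ∈ s, rankOne ℝ (v b) (v b)) x) := by
  simp only [sum_rankOne_apply, inner_sum, inner_smul_right]
  exact Finset.sum_congr rfl fun b hb => by rw [h a ha b hb]

lemma sum_rankOne_comp_of_gram_eq :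
    (∑ a ∈ s, rankOne ℝ (w a) (v a)) ∘L (∑ a ∈ s, rankOne ℝ (v a) (v a))
      = (∑ a ∈ s, rankOne ℝ (w a) (w a)) ∘L (∑ a ∈ s, rankOne ℝ (w a) (v a)) := by
  ext1 x
  rw [ContinuousLinearMap.comp_apply, ContinuousLinearMap.comp_apply, sum_rankOne_apply s w v,
    sum_rankOne_apply s w w]
  exact Finset.sum_congr rfl fun a ha => by rw [inner_sum_rankOne_of_gram_eq h ha]

lemma sum_rankOne_eq_zero_of_gram_eq {x : E} (hx : (∑ a ∈ s, rankOne ℝ (w a) (v a)) x = 0) :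
    (∑ a ∈ s, rankOne ℝ (v a) (v a)) x = 0 := by
  have hzero : ∀ a ∈ s, inner ℝ (v a) ((∑ b ∈ s, rankOne ℝ (v b) (v b)) x) = 0 := fun a ha => by
    rw [← inner_sum_rankOne_of_gram_eq h ha, hx, inner_zero_right]
  rw [← inner_self_eq_zero (𝕜 := ℝ)]
  nth_rewrite 1 [sum_rankOne_apply]
  rw [sum_inner]
  exact Finset.sum_eq_zero fun a ha => by rw [inner_smul_left, hzero a ha, mul_zero]

lemma eig_sum_rankOne_eq_of_gram_eq [CompleteSpace E] [CompleteSpace E'] {p : ℤ} (hp : p ≠ 0) :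
    eig (∑ a ∈ s, rankOne ℝ (v a) (v a)) p = eig (∑ a ∈ s, rankOne ℝ (w a) (w a)) p :=
  have h' : ∀ a ∈ s, ∀ b ∈ s, inner ℝ (w a) (w b) = inner ℝ (v a) (v b) := fun a ha b hb =>
    (h a ha b hb).symm
  eig_eq_of_intertwining (isCompactOperator_sum_rankOne s v v) (isSelfAdjoint_sum_rankOne s v)
    (isCompactOperator_sum_rankOne s w w) (isSelfAdjoint_sum_rankOne s w)
    (sum_rankOne_comp_of_gram_eq h) (fun _ => sum_rankOne_eq_zero_of_gram_eq h)
    (sum_rankOne_comp_of_gram_eq h') (fun _ => sum_rankOne_eq_zero_of_gram_eq h') hp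

end Gram

end SumRankOne

section StrongConvergence

variable {ι α β : Type*} {l : Filter ι}

lemma tendsto_apply_of_lipschitzWith [PseudoMetricSpace α] [PseudoMetricSpace β] {f : ι → α → β}
    {C : NNReal} (hf : ∀ i, LipschitzWith C (f i)) {y : ι → α} {a : α} {b : β}
    (hy : Tendsto y l (𝓝 a)) (ha : Tendsto (fun i => f i a) l (𝓝 b)) :
    Tendsto (fun i => f i (y i)) l (𝓝 b) :=
  tendsto_of_tendsto_of_dist ha <| squeeze_zero (fun _ => dist_nonneg)
    (fun i => (hf i).dist_le_mul a (y i))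
    (by simpa [dist_comm] using (tendsto_iff_dist_tendsto_zero.1 hy).const_mul (C : ℝ))

lemma tendsto_Lp_of_dominated [l.IsCountablyGenerated] [MeasurableSpace α] {μ : Measure α}
    [NormedAddCommGroup β] {p : ENNReal} [Fact (1 ≤ p)] (hp : p ≠ ⊤) {F : ι → Lp β p μ}
    {f : Lp β p μ} {g : α → ℝ} (hg : MemLp g p μ) (hFg : ∀ i, ∀ᵐ a ∂μ, ‖F i a - f a‖ ≤ g a)
    (hlim : ∀ᵐ a ∂μ, Tendsto (fun i => F i a) l (𝓝 (f a))) : Tendsto F l (𝓝 f) := by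
  have hp0 : p ≠ 0 := (zero_lt_one.trans_le Fact.out).ne'
  have hpos : 0 < p.toReal := ENNReal.toReal_pos hp0 hp
  have hint : Tendsto (fun i => ∫⁻ a, ‖F i a - f a‖ₑ ^ p.toReal ∂μ) l (𝓝 (∫⁻ _, 0 ∂μ)) := by
    refine tendsto_lintegral_filter_of_dominated_convergence' (fun a => ‖g a‖ₑ ^ p.toReal)
      (.of_forall fun i => ?_) (.of_forall fun i => ?_)
      (lintegral_rpow_enorm_lt_top_of_eLpNorm_lt_top hp0 hp hg.2).ne ?_
    · exact ((Lp.aestronglyMeasurable (F i)).sub (Lp.aestronglyMeasurable f)).enorm.pow_const _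
    · filter_upwards [hFg i] with a ha
      exact ENNReal.rpow_le_rpow (enorm_le_iff_norm_le.2 (ha.trans (le_abs_self _))) hpos.le
    · filter_upwards [hlim] with a ha
      simpa [hpos] using ((ha.sub_const (f a)).enorm).ennrpow_const p.toReal
  rw [lintegral_zero] at hint
  rw [Lp.tendsto_Lp_iff_tendsto_eLpNorm']
  simp only [eLpNorm_eq_lintegral_rpow_enorm_toReal hp0 hp, Pi.sub_apply]
  simpa [hpos] using hint.ennrpow_const (1 / p.toReal)

end StrongConvergence

lemma norm_sq_le_integral_abs {F : Signal} (h : ∀ᵐ u, |F u| ≤ 1) : ‖F‖ ^ 2 ≤ ∫ u, |F u| := by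
  rw [← real_inner_self_eq_norm_sq, L2.inner_def]
  refine integral_mono_ae (L2.integrable_inner F F) (signal_integrable F).abs ?_
  filter_upwards [h] with u hu
  simpa [← pow_two] using mul_le_of_le_one_left (abs_nonneg (F u)) hu

section CutNorm

variable {k : unitInterval → unitInterval → ℝ}

lemma abs_setIntegral_prod_le_cutNorm (hk : Integrable (Function.uncurry k))
    {A B : Set unitInterval} (hA : MeasurableSet A) (hB : MeasurableSet B) :
    |∫ z in A ×ˢ B, k z.1 z.2| ≤ cutNorm k := by
  refine le_ciSup (f := fun S : {S : Set unitInterval × Set unitInterval //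
    MeasurableSet S.1 ∧ MeasurableSet S.2} => |∫ z in S.1.1 ×ˢ S.1.2, k z.1 z.2|)
    ⟨∫ z, ‖Function.uncurry k z‖, ?_⟩ ⟨(A, B), hA, hB⟩
  rintro _ ⟨S, rfl⟩
  exact (norm_integral_le_integral_norm _).trans
    (setIntegral_le_integral hk.norm (.of_forall fun _ => norm_nonneg _))

lemma integral_abs_setIntegral_le_cutNorm (hm : Measurable (Function.uncurry k))
    (hk : Integrable (Function.uncurry k)) {B : Set unitInterval} (hB : MeasurableSet B) :
    ∫ u, |∫ v in B, k u v| ≤ 2 * cutNorm k := by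
  have hkB : Integrable (Function.uncurry k) (volume.prod (volume.restrict B)) := by
    simpa [Measure.volume_eq_prod, ← Measure.prod_restrict] using
      hk.restrict (s := Set.univ ×ˢ B)
  have hgm : Measurable fun u => ∫ v in B, k u v :=
    (hm.stronglyMeasurable.integral_prod_right (ν := volume.restrict B)).measurable
  have hfub : ∀ A : Set unitInterval,
      ∫ u in A, ∫ v in B, k u v = ∫ z in A ×ˢ B, k z.1 z.2 := fun A =>
    (setIntegral_prod (fun z : unitInterval × unitInterval => k z.1 z.2) hk.integrableOn).symm
  calc ∫ u, |∫ v in B, k u v|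
      = (∫ z in {u | 0 ≤ ∫ v in B, k u v} ×ˢ B, k z.1 z.2)
          - ∫ z in {u | ∫ v in B, k u v ≤ 0} ×ˢ B, k z.1 z.2 := by
        rw [← hfub, ← hfub]
        exact integral_norm_eq_pos_sub_neg hkB.integral_prod_left
    _ ≤ cutNorm k + cutNorm k := (le_abs_self _).trans <| (abs_sub _ _).trans <| add_le_add
        (abs_setIntegral_prod_le_cutNorm hk (measurableSet_le measurable_const hgm) hB)
        (abs_setIntegral_prod_le_cutNorm hk (measurableSet_le hgm measurable_const) hB)
    _ = 2 * cutNorm k := (two_mul _).symm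

end CutNorm

section GraphonOperator

variable (W W' : Graphon)

lemma Graphon.op_indicatorConstLp_ae {B : Set unitInterval} (hB : MeasurableSet B) :
    ∀ᵐ u, W.op (indicatorConstLp 2 hB (measure_ne_top _ _) (1 : ℝ)) u = ∫ v in B, W u v := by
  filter_upwards [W.opFun_ae (indicatorConstLp 2 hB (measure_ne_top _ _) (1 : ℝ))] with u hu
  rw [W.op_apply, hu, ← integral_indicator hB]
  refine integral_congr_ae ?_
  filter_upwards [indicatorConstLp_coeFn (p := 2) (hs := hB) (hμs := measure_ne_top _ _)
    (c := (1 : ℝ))] with v hv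
  by_cases h : v ∈ B <;> simp [hv, h]

lemma Graphon.integrableOn (u : unitInterval) (B : Set unitInterval) : IntegrableOn (W u) B :=
  .of_bound (measure_lt_top _ _) W.measurable.of_uncurry_left.aestronglyMeasurable 1
    (.of_forall fun v => by simpa [abs_of_nonneg (W.nonneg u v)] using W.le_one u v)

lemma Graphon.abs_sub_le_one (u v : unitInterval) : |W u v - W' u v| ≤ 1 :=
  abs_sub_le_of_nonneg_of_le (W.nonneg u v) (W.le_one u v) (W'.nonneg u v) (W'.le_one u v)

lemma Graphon.norm_sq_op_sub_op_indicatorConstLp_le {B : Set unitInterval}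
    (hB : MeasurableSet B) :
    ‖W.op (indicatorConstLp 2 hB (measure_ne_top _ _) (1 : ℝ))
        - W'.op (indicatorConstLp 2 hB (measure_ne_top _ _) (1 : ℝ))‖ ^ 2
      ≤ 2 * cutNorm fun u v => W u v - W' u v := by
  set F : Signal := W.op (indicatorConstLp 2 hB (measure_ne_top _ _) (1 : ℝ))
    - W'.op (indicatorConstLp 2 hB (measure_ne_top _ _) (1 : ℝ)) with hF
  have hm : Measurable (Function.uncurry fun u v => W u v - W' u v) :=
    W.measurable.sub W'.measurable
  have hFB : ∀ᵐ u, F u = ∫ v in B, (W u v - W' u v) := by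
    filter_upwards [Lp.coeFn_sub (W.op _) (W'.op _), W.op_indicatorConstLp_ae hB,
      W'.op_indicatorConstLp_ae hB] with u hsub hW hW'
    rw [hF, hsub, Pi.sub_apply, hW, hW', integral_sub (W.integrableOn u B) (W'.integrableOn u B)]
  have hF1 : ∀ᵐ u, |F u| ≤ 1 := by
    filter_upwards [hFB] with u hu
    rw [hu]
    refine (norm_setIntegral_le_of_norm_le_const (f := fun v => W u v - W' u v)
      (measure_lt_top _ _) fun v _ => W.abs_sub_le_one W' u v).trans ?_
    rw [one_mul]
    exact measureReal_le_one
  calc ‖F‖ ^ 2 ≤ ∫ u, |F u| := norm_sq_le_integral_abs hF1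
    _ = ∫ u, |∫ v in B, (W u v - W' u v)| :=
        integral_congr_ae (hFB.mono fun u hu => congrArg abs hu)
    _ ≤ 2 * cutNorm fun u v => W u v - W' u v :=
        integral_abs_setIntegral_le_cutNorm hm (.of_bound hm.aestronglyMeasurable 1
          (.of_forall fun z => W.abs_sub_le_one W' z.1 z.2)) hB

lemma Graphon.lipschitzWith_op : LipschitzWith 1 W.op :=
  W.op.lipschitz.weaken (by
    rw [← NNReal.coe_le_coe]
    exact LinearMap.mkContinuous_norm_le _ zero_le_one _)

end GraphonOperator

lemma conv_apply (K : ℕ) (c : ℕ → ℝ) (W : Graphon) (X : Signal) :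
    conv K c W X = ∑ k ∈ Finset.range K, c k • (W.op ^ k) X := by
  simp only [conv, sum_apply, smul_apply]

section Nonlinearity

variable {σ : ℝ → ℝ} (hσ : LipschitzWith 1 σ)

lemma activation_ae (U : Signal) : ∀ᵐ u, activation hσ U u = σ (U u) :=
  (memLp_activation hσ U).coeFn_toLp

lemma derivMul_ae (U V : Signal) : ∀ᵐ u, derivMul hσ U V u = deriv σ (U u) * V u :=
  (memLp_deriv_mul hσ U V).coeFn_toLp

lemma lipschitzWith_activation : LipschitzWith 1 (activation hσ) :=
  .of_dist_le_mul fun U V => by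
    simpa [dist_eq_norm] using norm_activation_sub_le hσ U V

include hσ in
lemma abs_deriv_mul_le_abs (t s : ℝ) : |deriv σ t * s| ≤ |s| := by
  rw [abs_mul]
  exact mul_le_of_le_one_left (abs_nonneg s) (by simpa using norm_deriv_le_of_lipschitz hσ)

lemma lipschitzWith_derivMul (U : Signal) : LipschitzWith 1 (derivMul hσ U) :=
  .of_dist_le_mul fun V V' => by
    rw [dist_eq_norm, dist_eq_norm, NNReal.coe_one, one_mul]
    refine Lp.norm_le_norm_of_ae_le ?_
    filter_upwards [Lp.coeFn_sub (derivMul hσ U V) (derivMul hσ U V'), Lp.coeFn_sub V V',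
      derivMul_ae hσ U V, derivMul_ae hσ U V'] with u hsub hsub' hV hV'
    rw [hsub, hsub', Pi.sub_apply, Pi.sub_apply, hV, hV', ← mul_sub]
    exact abs_deriv_mul_le_abs hσ _ _

variable {ι : Type*} {l : Filter ι} [l.IsCountablyGenerated] {Un Vn : ι → Signal} {U V : Signal}

lemma tendsto_derivMul_left (hU : Tendsto Un l (𝓝 U))
    (hc : ∀ᵐ u, ContinuousAt (deriv σ) (U u)) (V : Signal) :
    Tendsto (fun n => derivMul hσ (Un n) V) l (𝓝 (derivMul hσ U V)) := by
  refine tendsto_of_subseq_tendsto fun ns hns => ?_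
  obtain ⟨ms, -, hms⟩ := (tendstoInMeasure_of_tendsto_Lp (hU.comp hns)).exists_seq_tendsto_ae
  refine ⟨ms, tendsto_Lp_of_dominated ENNReal.ofNat_ne_top
    ((Lp.memLp V).norm.const_mul 2) (fun n => ?_) ?_⟩
  · filter_upwards [derivMul_ae hσ (Un (ns (ms n))) V, derivMul_ae hσ U V] with u hn hu
    rw [hn, hu, two_mul]
    exact (norm_sub_le _ _).trans
      (add_le_add (abs_deriv_mul_le_abs hσ _ _) (abs_deriv_mul_le_abs hσ _ _))
  · filter_upwards [hms, hc, derivMul_ae hσ U V,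
      ae_all_iff.2 fun n => derivMul_ae hσ (Un (ns (ms n))) V] with u hlim hcont hu hn
    simp only [hu, hn]
    exact (hcont.tendsto.comp hlim).mul_const (V u)

lemma tendsto_derivMul (hU : Tendsto Un l (𝓝 U)) (hc : ∀ᵐ u, ContinuousAt (deriv σ) (U u))
    (hV : Tendsto Vn l (𝓝 V)) :
    Tendsto (fun n => derivMul hσ (Un n) (Vn n)) l (𝓝 (derivMul hσ U V)) :=
  tendsto_apply_of_lipschitzWith (fun n => lipschitzWith_derivMul hσ (Un n)) hV
    (tendsto_derivMul_left hσ hU hc V)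

end Nonlinearity

section Limit

variable {ι : Type*} {l : Filter ι} {Wn : ι → Graphon} {W : Graphon} {Yn : ι → Signal}
  {Y : Signal}

lemma tendsto_op_apply_of_tendsto_cutNorm
    (hW : Tendsto (fun n => cutNorm fun u v => Wn n u v - W u v) l (𝓝 0)) (X : Signal) :
    Tendsto (fun n => (Wn n).op X) l (𝓝 (W.op X)) := by
  have hind : ∀ (B : Set unitInterval) (hB : MeasurableSet B),
      Tendsto (fun n => (Wn n).op (indicatorConstLp 2 hB (measure_ne_top _ _) (1 : ℝ))) l
        (𝓝 (W.op (indicatorConstLp 2 hB (measure_ne_top _ _) (1 : ℝ)))) := fun B hB =>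
    tendsto_iff_norm_sub_tendsto_zero.2 <| squeeze_zero (fun _ => norm_nonneg _)
      (fun n => Real.le_sqrt_of_sq_le ((Wn n).norm_sq_op_sub_op_indicatorConstLp_le W hB))
      (by simpa using (hW.const_mul 2).sqrt)
  induction X using Lp.induction (p := 2) ENNReal.ofNat_ne_top with
  | @indicatorConst c B hB hμ =>
    have hc : (Lp.simpleFunc.indicatorConst 2 hB hμ.ne c : Signal)
        = c • indicatorConstLp 2 hB (measure_ne_top _ _) (1 : ℝ) := by
      rw [Lp.simpleFunc.coe_indicatorConst, indicatorConstLp, indicatorConstLp,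
        ← MemLp.toLp_const_smul]
      exact MemLp.toLp_congr _ _ (.of_forall fun v => by
        by_cases hv : v ∈ B <;> simp [hv])
    simpa only [hc, map_smul] using (hind _ hB).const_smul c
  | add hf hg _ ihf ihg => simpa only [map_add] using ihf.add ihg
  | isClosed =>
    exact (LipschitzWith.uniformEquicontinuous _ 1 fun n =>
      (Wn n).lipschitzWith_op).equicontinuous.isClosed_setOfPred_tendsto W.op.continuous

variable (hW : ∀ X, Tendsto (fun n => (Wn n).op X) l (𝓝 (W.op X))) (hY : Tendsto Yn l (𝓝 Y))

include hW hY

lemma tendsto_op_pow_apply (k : ℕ) :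
    Tendsto (fun n => ((Wn n).op ^ k) (Yn n)) l (𝓝 ((W.op ^ k) Y)) := by
  induction k with
  | zero => simpa using hY
  | succ k ih =>
    simp only [pow_succ', mul_apply_eq_comp]
    exact tendsto_apply_of_lipschitzWith (fun n => (Wn n).lipschitzWith_op) ih (hW _)

lemma tendsto_conv_apply (K : ℕ) (c : ℕ → ℝ) :
    Tendsto (fun n => conv K c (Wn n) (Yn n)) l (𝓝 (conv K c W Y)) := by
  simp only [conv_apply]
  exact tendsto_finsetSum _ fun k _ => (tendsto_op_pow_apply hW hY k).const_smul (c k)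

variable {σ : ℝ → ℝ} (hσ : LipschitzWith 1 σ) (K : ℕ) (h : ℕ → ℕ → ℝ)

lemma tendsto_layer (m : ℕ) :
    Tendsto (fun n => layer hσ K h (Wn n) (Yn n) m) l (𝓝 (layer hσ K h W Y m)) := by
  induction m with
  | zero => exact hY
  | succ m ih =>
    exact ((lipschitzWith_activation hσ).continuous.tendsto _).comp (tendsto_conv_apply hW ih K _)

lemma tendsto_preact (m : ℕ) :
    Tendsto (fun n => preact hσ K h (Wn n) (Yn n) m) l (𝓝 (preact hσ K h W Y m)) :=
  tendsto_conv_apply hW (tendsto_layer hW hY hσ K h (m - 1)) K _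

lemma tendsto_layerDeriv [l.IsCountablyGenerated] (j k m : ℕ)
    (hreg : ∀ i ∈ Finset.Icc 1 m, ∀ᵐ u, ContinuousAt (deriv σ) (preact hσ K h W Y i u)) :
    Tendsto (fun n => layerDeriv hσ K h (Wn n) (Yn n) j k m) l
      (𝓝 (layerDeriv hσ K h W Y j k m)) := by
  induction m with
  | zero => exact tendsto_const_nhds
  | succ m ih =>
    have hmono : Finset.Icc 1 m ⊆ Finset.Icc 1 (m + 1) := Finset.Icc_subset_Icc_right m.le_succ
    refine tendsto_derivMul hσ (tendsto_preact hW hY hσ K h (m + 1))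
      (hreg (m + 1) (Finset.right_mem_Icc.2 m.succ_pos)) ?_
    split_ifs
    · exact tendsto_op_pow_apply hW (tendsto_layer hW hY hσ K h m) k
    · exact tendsto_conv_apply hW (ih fun i hi => hreg i (hmono hi)) K _

end Limit

section Cells

variable {n : ℕ}

lemma cell_ae_eq_Icc (i : Fin n) {a b : unitInterval} (ha : (a : ℝ) = i / n)
    (hb : (b : ℝ) = (i + 1) / n) : cell n i =ᵐ[volume] Set.Icc a b := by
  have hlast : (i : ℕ) + 1 = n → (b : ℝ) = 1 := fun h => by
    rw [hb, div_eq_one_iff_eq (Nat.cast_ne_zero.2 i.pos.ne')]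
    exact_mod_cast h
  filter_upwards [Measure.ae_ne volume b] with u hu
  refine propext (and_congr (by rw [← ha, Subtype.coe_le_coe]) ?_)
  rw [← hb, Subtype.coe_lt_coe]
  refine ⟨?_, fun h => .inl (lt_of_le_of_ne h hu)⟩
  rintro (h | h)
  · exact h.le
  · exact u.2.2.trans (hlast h).ge

lemma volume_real_cell (i : Fin n) : volume.real (cell n i) = 1 / n := by
  have hn : (0 : ℝ) < n := by exact_mod_cast i.pos
  have hi : (i : ℝ) + 1 ≤ n := by exact_mod_cast i.2
  have ha : (i : ℝ) / n ∈ unitInterval := ⟨by positivity, (div_le_one hn).2 (by linarith)⟩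
  have hb : ((i : ℝ) + 1) / n ∈ unitInterval := ⟨by positivity, (div_le_one hn).2 hi⟩
  rw [measureReal_congr (cell_ae_eq_Icc i (a := ⟨_, ha⟩) (b := ⟨_, hb⟩) rfl rfl), measureReal_def,
    unitInterval.volume_Icc, ← sub_div, add_sub_cancel_left, ENNReal.toReal_ofReal (by positivity)]

open Classical in
lemma sum_ite_mem_cell {u : unitInterval} {i : Fin n} (hu : u ∈ cell n i) (y : Fin n → ℝ) :
    ∑ j, (if u ∈ cell n j then y j else 0) = y i := by
  rw [Finset.sum_eq_single_of_mem i (Finset.mem_univ i)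
    fun j _ hj => if_neg fun h => hj (cell_disjoint h hu), if_pos hu]

lemma inducedSignal_ae (y : Fin n → ℝ) : ∀ᵐ u, ∀ i, u ∈ cell n i → inducedSignal y u = y i := by
  filter_upwards [(memLp_inducedSignal y).coeFn_toLp] with u hu i hi
  rw [inducedSignal, hu, sum_ite_mem_cell hi]

lemma inducedGraphon_apply (G : WGraph n) {u v : unitInterval} {i j : Fin n} (hu : u ∈ cell n i)
    (hv : v ∈ cell n j) : G.inducedGraphon u v = G.w i j := by
  classical
  change ∑ a, ∑ b, (if u ∈ cell n a ∧ v ∈ cell n b then G.w a b else 0) = G.w i j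
  simp only [ite_and, Finset.sum_ite_irrel, Finset.sum_const_zero]
  rw [sum_ite_mem_cell hu fun a => ∑ b, if v ∈ cell n b then G.w a b else 0, sum_ite_mem_cell hv]

lemma exists_mem_cell (n : ℕ) [NeZero n] (u : unitInterval) : ∃ i, u ∈ cell n i := by
  have hn : (0 : ℝ) < n := Nat.cast_pos.2 (NeZero.pos n)
  have hfloor : (⌊(u : ℝ) * n⌋₊ : ℝ) ≤ u * n := Nat.floor_le (mul_nonneg u.2.1 hn.le)
  by_cases h : ⌊(u : ℝ) * n⌋₊ < n
  · exact ⟨⟨_, h⟩, (div_le_iff₀ hn).2 hfloor, .inl ((lt_div_iff₀ hn).2 (Nat.lt_floor_add_one _))⟩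
  · have hlast : ((n - 1 : ℕ) : ℝ) ≤ ⌊(u : ℝ) * n⌋₊ := by exact_mod_cast by omega
    exact ⟨⟨n - 1, Nat.sub_one_lt (NeZero.ne n)⟩, (div_le_iff₀ hn).2 (hlast.trans hfloor),
      .inr (Nat.sub_add_cancel NeZero.one_le)⟩

variable [NeZero n]

lemma eq_inducedSignal {Y : Signal} {y : Fin n → ℝ}
    (h : ∀ᵐ u, ∀ i, u ∈ cell n i → Y u = y i) : Y = inducedSignal y := by
  refine Lp.ext ?_
  filter_upwards [h, inducedSignal_ae y] with u hY hy
  obtain ⟨i, hi⟩ := exists_mem_cell n u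
  rw [hY i hi, hy i hi]

lemma integral_eq_of_ae_eq_on_cell {f : unitInterval → ℝ} {y : Fin n → ℝ}
    (h : ∀ᵐ u, ∀ i, u ∈ cell n i → f u = y i) : ∫ u, f u = (∑ i, y i) / n := by
  classical
  have hf : f =ᵐ[volume] fun u => ∑ i, (cell n i).indicator (fun _ => y i) u := by
    filter_upwards [h] with u hu
    obtain ⟨i, hi⟩ := exists_mem_cell n u
    simp only [Set.indicator_apply]
    rw [hu i hi, ← sum_ite_mem_cell hi y]
  rw [integral_congr_ae hf, integral_finsetSum _ fun i _ =>
    (integrable_const _).indicator (measurableSet_cell n i), Finset.sum_div]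
  refine Finset.sum_congr rfl fun i _ => ?_
  rw [integral_indicator_const _ (measurableSet_cell n i), volume_real_cell, smul_eq_mul,
    one_div_mul_eq_div]

lemma inner_inducedSignal (y z : Fin n → ℝ) :
    inner ℝ (inducedSignal y) (inducedSignal z) = (∑ i, y i * z i) / n := by
  rw [L2.inner_def]
  refine integral_eq_of_ae_eq_on_cell ?_
  filter_upwards [inducedSignal_ae y, inducedSignal_ae z] with u hy hz i hi
  rw [hy i hi, hz i hi]
  exact mul_comm _ _

lemma op_inducedSignal (G : WGraph n) (y : Fin n → ℝ) :
    G.inducedGraphon.op (inducedSignal y) = inducedSignal fun i => (∑ j, G.w i j * y j) / n := by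
  refine eq_inducedSignal ?_
  filter_upwards [G.inducedGraphon.opFun_ae (inducedSignal y)] with u hu i hi
  rw [Graphon.op_apply, hu]
  refine integral_eq_of_ae_eq_on_cell ?_
  filter_upwards [inducedSignal_ae y] with v hv j hj
  rw [inducedGraphon_apply G hi hj, hv j hj]

lemma activation_inducedSignal {σ : ℝ → ℝ} (hσ : LipschitzWith 1 σ) (y : Fin n → ℝ) :
    activation hσ (inducedSignal y) = inducedSignal (σ ∘ y) := by
  refine eq_inducedSignal ?_
  filter_upwards [activation_ae hσ (inducedSignal y), inducedSignal_ae y] with u hu hy i hi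
  rw [hu, hy i hi, Function.comp_apply]

lemma derivMul_inducedSignal {σ : ℝ → ℝ} (hσ : LipschitzWith 1 σ) (y z : Fin n → ℝ) :
    derivMul hσ (inducedSignal y) (inducedSignal z)
      = inducedSignal fun i => deriv σ (y i) * z i := by
  refine eq_inducedSignal ?_
  filter_upwards [derivMul_ae hσ (inducedSignal y) (inducedSignal z), inducedSignal_ae y,
    inducedSignal_ae z] with u hu hy hz i hi
  rw [hu, hy i hi, hz i hi]

end Cells

section Relabelling

/-- The pairs `(Y, Y')` of induced signals such that `Y'` comes from `Y` by relabelling the nodes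
with `π`. All layers of the network, and their derivatives, stay in this subspace when it is run on
a graph signal and on its relabelling. -/
def relabelledPairs {n : ℕ} [NeZero n] (π : Equiv.Perm (Fin n)) :
    Submodule ℝ (Signal × Signal) where
  carrier := {p | ∃ y : Fin n → ℝ, p = (inducedSignal y, inducedSignal (y ∘ π))}
  add_mem' := by
    have hadd (y z : Fin n → ℝ) : inducedSignal y + inducedSignal z = inducedSignal (y + z) := by
      refine eq_inducedSignal ?_
      filter_upwards [Lp.coeFn_add (inducedSignal y) (inducedSignal z), inducedSignal_ae y,
        inducedSignal_ae z] with u hu hy hz i hi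
      rw [hu, Pi.add_apply, Pi.add_apply, hy i hi, hz i hi]
    rintro _ _ ⟨y, rfl⟩ ⟨z, rfl⟩
    exact ⟨y + z, Prod.ext (hadd _ _) (hadd _ _)⟩
  zero_mem' := by
    have hzero : (0 : Signal) = inducedSignal (0 : Fin n → ℝ) := by
      refine eq_inducedSignal ?_
      filter_upwards [Lp.coeFn_zero ℝ 2 (volume : Measure unitInterval)] with u hu i _
      rw [hu, Pi.zero_apply, Pi.zero_apply]
    exact ⟨0, Prod.ext hzero hzero⟩
  smul_mem' := by
    have hsmul (c : ℝ) (y : Fin n → ℝ) : c • inducedSignal y = inducedSignal (c • y) := by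
      refine eq_inducedSignal ?_
      filter_upwards [Lp.coeFn_smul c (inducedSignal y), inducedSignal_ae y] with u hu hy i hi
      rw [hu, Pi.smul_apply, Pi.smul_apply, hy i hi]
    rintro c _ ⟨y, rfl⟩
    exact ⟨c • y, Prod.ext (hsmul c _) (hsmul c _)⟩

namespace relabelledPairs

variable {n : ℕ} [NeZero n] (G : WGraph n) {π : Equiv.Perm (Fin n)} {Y Y' Z Z' : Signal}

lemma inner_eq (hY : (Y, Y') ∈ relabelledPairs π) (hZ : (Z, Z') ∈ relabelledPairs π) :
    inner ℝ Y' Z' = inner ℝ Y Z := by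
  obtain ⟨y, ⟨⟩⟩ := hY
  obtain ⟨z, ⟨⟩⟩ := hZ
  simp only [inner_inducedSignal, Function.comp_apply]
  rw [Equiv.sum_comp π fun i => y i * z i]

lemma op_mem (hY : (Y, Y') ∈ relabelledPairs π) :
    (G.inducedGraphon.op Y, (G.relabel π).inducedGraphon.op Y') ∈ relabelledPairs π := by
  obtain ⟨y, ⟨⟩⟩ := hY
  refine ⟨fun i => (∑ j, G.w i j * y j) / n, ?_⟩
  rw [op_inducedSignal, op_inducedSignal]
  congr! 3 with i
  simp only [WGraph.relabel, Function.comp_apply]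
  rw [Equiv.sum_comp π fun j => G.w (π i) j * y j]

lemma op_pow_mem (hY : (Y, Y') ∈ relabelledPairs π) (k : ℕ) :
    ((G.inducedGraphon.op ^ k) Y, ((G.relabel π).inducedGraphon.op ^ k) Y')
      ∈ relabelledPairs π := by
  induction k with
  | zero => exact hY
  | succ k ih =>
    simp only [pow_succ', mul_apply_eq_comp]
    exact op_mem G ih

lemma conv_mem (hY : (Y, Y') ∈ relabelledPairs π) (K : ℕ) (c : ℕ → ℝ) :
    (conv K c G.inducedGraphon Y, conv K c (G.relabel π).inducedGraphon Y')
      ∈ relabelledPairs π := by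
  rw [conv_apply, conv_apply, prod_mk_sum]
  exact sum_mem fun k _ => Submodule.smul_mem _ (c k) (op_pow_mem G hY k)

variable {σ : ℝ → ℝ} (hσ : LipschitzWith 1 σ)

lemma activation_mem (hY : (Y, Y') ∈ relabelledPairs π) :
    (activation hσ Y, activation hσ Y') ∈ relabelledPairs π := by
  obtain ⟨y, ⟨⟩⟩ := hY
  exact ⟨σ ∘ y, by rw [activation_inducedSignal, activation_inducedSignal, Function.comp_assoc]⟩

lemma derivMul_mem (hY : (Y, Y') ∈ relabelledPairs π) (hZ : (Z, Z') ∈ relabelledPairs π) :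
    (derivMul hσ Y Z, derivMul hσ Y' Z') ∈ relabelledPairs π := by
  obtain ⟨y, ⟨⟩⟩ := hY
  obtain ⟨z, ⟨⟩⟩ := hZ
  exact ⟨_, by rw [derivMul_inducedSignal, derivMul_inducedSignal]; rfl⟩

variable (K : ℕ) (h : ℕ → ℕ → ℝ)

lemma layer_mem (hY : (Y, Y') ∈ relabelledPairs π) (m : ℕ) :
    (layer hσ K h G.inducedGraphon Y m, layer hσ K h (G.relabel π).inducedGraphon Y' m)
      ∈ relabelledPairs π := by
  induction m with
  | zero => exact hY
  | succ m ih => exact activation_mem hσ (conv_mem G ih K _)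

lemma layerDeriv_mem (hY : (Y, Y') ∈ relabelledPairs π) (l k m : ℕ) :
    (layerDeriv hσ K h G.inducedGraphon Y l k m,
      layerDeriv hσ K h (G.relabel π).inducedGraphon Y' l k m) ∈ relabelledPairs π := by
  induction m with
  | zero => exact zero_mem _
  | succ m ih =>
    refine derivMul_mem hσ (conv_mem G (layer_mem G hσ K h hY m) K _) ?_
    split_ifs
    · exact op_pow_mem G (layer_mem G hσ K h hY m) k
    · exact conv_mem G ih K _

end relabelledPairs

end Relabelling

section TangentKernel

variable {σ : ℝ → ℝ} (hσ : LipschitzWith 1 σ) (L K : ℕ) (h : ℕ → ℕ → ℝ) {M : ℕ}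

/-- The family of the derivatives of the network outputs `f(X_i; W, H)`, `i < M`, in the weight
`h l k` with `(l, k) = a`. The tangent kernel of the `M` signals is the sum over `a` of the rank-one
operators of these vectors. -/
def outputDeriv (W : Graphon) (X : Fin M → Signal) (a : ℕ × ℕ) : Signals M :=
  WithLp.toLp 2 fun i => layerDeriv hσ K h W (X i) a.1 a.2 L

lemma ntkMatrix_eq_sum_rankOne (W : Graphon) (X : Fin M → Signal) :
    ntkMatrix hσ L K h W X = ∑ a ∈ Finset.Icc 1 L ×ˢ Finset.range K,
      InnerProductSpace.rankOne ℝ (outputDeriv hσ L K h W X a) (outputDeriv hσ L K h W X a) := by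
  ext1 Y
  refine PiLp.ext fun i => ?_
  calc (ntkMatrix hσ L K h W X Y) i = ∑ j, wntk hσ L K h W (X i) (X j) (Y j) := by
        simp [ntkMatrix, blockOp]
    _ = ∑ a ∈ Finset.Icc 1 L ×ˢ Finset.range K,
          (∑ j, inner ℝ (outputDeriv hσ L K h W X a j) (Y j)) • outputDeriv hσ L K h W X a i := by
        simp only [wntk, sum_apply, InnerProductSpace.rankOne_apply, outputDeriv, Finset.sum_smul,
          ← Finset.sum_product' (Finset.Icc 1 L)]
        exact Finset.sum_comm
    _ = _ := by
        simp [PiLp.inner_apply]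

lemma isCompactOperator_ntkMatrix (W : Graphon) (X : Fin M → Signal) :
    IsCompactOperator (ntkMatrix hσ L K h W X) := by
  rw [ntkMatrix_eq_sum_rankOne]
  exact isCompactOperator_sum_rankOne _ _ _

lemma isSelfAdjoint_ntkMatrix (W : Graphon) (X : Fin M → Signal) :
    IsSelfAdjoint (ntkMatrix hσ L K h W X) := by
  rw [ntkMatrix_eq_sum_rankOne]
  exact isSelfAdjoint_sum_rankOne _ _

lemma eig_ntkMatrix_relabel {n : ℕ} (G : WGraph n) (π : Equiv.Perm (Fin n))
    (x : Fin M → Fin n → ℝ) {p : ℤ} (hp : p ≠ 0) :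
    eig (ntkMatrix hσ L K h (G.relabel π).inducedGraphon fun i => inducedSignal (x i ∘ π)) p
      = eig (ntkMatrix hσ L K h G.inducedGraphon fun i => inducedSignal (x i)) p := by
  rcases eq_zero_or_neZero n with rfl | _
  · rw [Subsingleton.elim π 1]
    rfl
  rw [ntkMatrix_eq_sum_rankOne, ntkMatrix_eq_sum_rankOne]
  refine eig_sum_rankOne_eq_of_gram_eq (fun a _ b _ => ?_) hp
  have hmem (i : Fin M) (a : ℕ × ℕ) :=
    relabelledPairs.layerDeriv_mem G hσ K h (π := π) ⟨x i, rfl⟩ a.1 a.2 L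
  simp only [outputDeriv, PiLp.inner_apply]
  exact Finset.sum_congr rfl fun i _ => relabelledPairs.inner_eq (hmem i a) (hmem i b)

lemma tendsto_ntkMatrix {ι : Type*} {l : Filter ι} [l.IsCountablyGenerated] {Wn : ι → Graphon}
    {W : Graphon} (hW : ∀ X, Tendsto (fun n => (Wn n).op X) l (𝓝 (W.op X)))
    {Xn : ι → Fin M → Signal} {X : Fin M → Signal}
    (hX : ∀ i, Tendsto (fun n => Xn n i) l (𝓝 (X i)))
    (hreg : ∀ i, ∀ j ∈ Finset.Icc 1 L,
      ∀ᵐ u, ContinuousAt (deriv σ) (preact hσ K h W (X i) j u)) :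
    Tendsto (fun n => ntkMatrix hσ L K h (Wn n) (Xn n)) l (𝓝 (ntkMatrix hσ L K h W X)) := by
  simp only [ntkMatrix_eq_sum_rankOne]
  refine tendsto_finsetSum _ fun a _ => ?_
  have hderiv : Tendsto (fun n => outputDeriv hσ L K h (Wn n) (Xn n) a) l
      (𝓝 (outputDeriv hσ L K h W X a)) :=
    ((PiLp.continuous_toLp 2 fun _ : Fin M => Signal).tendsto _).comp <| tendsto_pi_nhds.2
      fun i => tendsto_layerDeriv hW (hX i) hσ K h _ _ _ (hreg i)
  have hrankOne : Continuous fun v : Signals M => InnerProductSpace.rankOne ℝ v v :=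
    (InnerProductSpace.rankOne ℝ (E := Signals M) (F := Signals M)).continuous.clm_apply
      continuous_id
  exact (hrankOne.tendsto _).comp hderiv

end TangentKernel

end GNTK

end

theorem theorem2
    -- the architecture: `L` layers, filters of order `K`, activation `σ`, weights `h l k`
    (L K : ℕ) (σ : ℝ → ℝ) (hσ : LipschitzWith 1 σ) (h : ℕ → ℕ → ℝ)
    -- `M` signals on each graph `G_n`, and the limit objects
    (M : ℕ) (G : ∀ n, WGraph n) (x : ∀ n, Fin M → Fin n → ℝ)
    (W : Graphon) (X : Fin M → Signal)
    -- `G_n → W`, and `(G_n, x_{i,n}) → (W, X_i)` up to the relabellings `π_n` of the nodes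
    (π : ∀ n, Equiv.Perm (Fin n))
    (hG : GraphsConverge G W)
    (hW : Tendsto
      (fun n => cutNorm fun u v => ((G n).relabel (π n)).inducedGraphon u v - W u v) atTop (𝓝 0))
    (hX : ∀ i, Tendsto (fun n => ‖inducedSignal (x n i ∘ π n) - X i‖) atTop (𝓝 0))
    -- the derivative `σ'` exists and is continuous at almost all pre-activations of the limit network
    (hreg : ∀ i, ∀ l ∈ Finset.Icc 1 L, ∀ᵐ u,
      DifferentiableAt ℝ σ (preact hσ K h W (X i) l u) ∧
        ContinuousAt (deriv σ) (preact hσ K h W (X i) l u))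
    -- the matrix operators: of the graphs, of the relabelled graphs, and of the limit
    (Θn Θnπ : ℕ → (Signals M →L[ℝ] Signals M)) (Θ : Signals M →L[ℝ] Signals M)
    (hΘn : ∀ n, Θn n =
      ntkMatrix hσ L K h (G n).inducedGraphon fun i => inducedSignal (x n i))
    (hΘnπ : ∀ n, Θnπ n =
      ntkMatrix hσ L K h ((G n).relabel (π n)).inducedGraphon fun i => inducedSignal (x n i ∘ π n))
    (hΘ : Θ = ntkMatrix hσ L K h W X) :
    -- all the operators are compact and self-adjoint
    (∀ n, IsCompactOperator (Θn n) ∧ IsSelfAdjoint (Θn n)) ∧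
    (∀ n, IsCompactOperator (Θnπ n) ∧ IsSelfAdjoint (Θnπ n)) ∧
    (IsCompactOperator Θ ∧ IsSelfAdjoint Θ) ∧
    -- the ordered eigenvalues converge, and do not depend on the labelling
    (∀ p : ℤ, p ≠ 0 →
      Tendsto (fun n => |eig (Θn n) p - eig Θ p|) atTop (𝓝 0) ∧
      ∀ n, eig (Θnπ n) p = eig (Θn n) p) ∧
    -- the spectral projectors converge in the operator norm
    (∀ p : ℤ, p ≠ 0 → eig Θ p ≠ 0 →
      Tendsto
        (fun n => spectralProj (Θnπ n) (eig (Θnπ n) '' {q | q ≠ 0 ∧ eig Θ q = eig Θ p}))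
        atTop (𝓝 (spectralProj Θ {eig Θ p}))) := by
  obtain rfl : Θn = _ := funext hΘn
  obtain rfl : Θnπ = _ := funext hΘnπ
  subst hΘ
  have hcompact {W'} {X' : Fin M → Signal} := isCompactOperator_ntkMatrix hσ L K h W' X'
  have hself {W'} {X' : Fin M → Signal} := isSelfAdjoint_ntkMatrix hσ L K h W' X'
  have hlim : Tendsto (fun n => ntkMatrix hσ L K h ((G n).relabel (π n)).inducedGraphon
      fun i => inducedSignal (x n i ∘ π n)) atTop (𝓝 (ntkMatrix hσ L K h W X)) :=
    tendsto_ntkMatrix hσ L K h (tendsto_op_apply_of_tendsto_cutNorm hW)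
      (fun i => tendsto_iff_norm_sub_tendsto_zero.2 (hX i))
      fun i l hl => (hreg i l hl).mono fun _ hu => hu.2
  refine ⟨fun _ => ⟨hcompact, hself⟩, fun _ => ⟨hcompact, hself⟩, ⟨hcompact, hself⟩,
    fun p hp => ?_, fun _ _ hne =>
      tendsto_spectralProj (fun _ => hcompact) (fun _ => hself) hcompact hself hlim hne⟩
  have hrelabel (n : ℕ) := eig_ntkMatrix_relabel hσ L K h (G n) (π n) (x n) hp
  refine ⟨?_, hrelabel⟩
  simp only [← hrelabel, ← Real.dist_eq]
  exact tendsto_iff_dist_tendsto_zero.1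
    (tendsto_eig (fun _ => hcompact) (fun _ => hself) hcompact hself hlim hp)
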